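/- Let $k,n\ge 1$ be integers and $0<\alpha<n$. Let $X:[0,1]^k\times\Omega\to\mathbb{R}^n$ be a (jointly measurable) centered Gaussian random field over a probability space $(\Omega,\mathcal F,\mathbb P)$ with $X(0)=0$ $\mathbb P$-a.s., and let $\varphi:[0,1]^k\to\mathbb{R}^n$ be a bounded Borel function. Write $\sigma^2(s,t)$ for the covariance matrix of $X(t)-X(s)$, and suppose that $\det\sigma^2(s,t)>0$ for $\mathcal L^{2k}$-a.e. $(s,t)\in[0,1]^{2k}$. Suppose that $X$ is locally nondeterministic in the following sense: for every $\ell\ge 2$ there are constants $c_\ell>0$ and $\varepsilon_\ell>0$ such that $$\mathrm{Var}\Big(\sum_{j=1}^{\ell}\big\langle u_j,\sigma_j^{-1}(X(t_j)-X(t_{j-1}))\big\rangle\Big)\ \ge\ c_\ell\sum_{j=1}^{\ell}|u_j|^2$$ for all $u_1,\dots,u_\ell\in\mathbb{R}^n$ and a.e. $(t_1,\dots,t_\ell)\in([0,1]^k)^\ell$ such that all $t_1,\dots,t_\ell$ lie in a common axis-parallel closed cube of side length $\varepsilon_\ell$ and, with $t_0:=0$, $|t_{j+1}-t_j|\le|t_{j+1}-t_i|$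 for all $0\le i\le j<\ell$. Here $\sigma_j$ is a root of the covariance matrix of $X(t_j)-X(t_{j-1})$, that is, $\sigma_j\sigma_j^T=\sigma^2(t_{j-1},t_j)$. Suppose finally that there is some $\delta>0$ with $$\operatorname*{ess\,sup}_{s\in[0,1]^k}\int_{[0,1]^k}\frac{dt}{|\det\sigma^2(s,t)|^{\frac{n-\alpha}{2n}+\delta}}<+\infty .$$ For $\omega\in\Omega$ let $\mu_{X+\varphi}(B)=\mathcal L^k(\{t\in[0,1]^k: X(t,\omega)+\varphi(t)\in B\})$, $B\subset\mathbb{R}^n$ Borel, be the occupation measure of $X(\cdot,\omega)+\varphi$, and let $G^\alpha\mu_{X+\varphi}(x)=\int_{\mathbb{R}^n}g_\alpha(x-y)\,\mu_{X+\varphi}(dy)$ be its Bessel potential of order $\alpha$, where $$g_\alpha(x)=\frac1{\Gamma(\alpha/2)}\int_0^\infty s^{\frac\alpha2-1}e^{-s}(4\pi s)^{-\frac n2}e^{-\frac{|x|^2}{4s}}\,ds$$ is the Bessel kernel, whose Fourier transform is $\hat g_\alpha(\xi)=(1+|\xi|^2)^{-\alpha/2}$. Then $G^\alpha\mu_{X+\varphi}$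 is $\mathbb P$-a.s. finite everywhere and locally Hölder continuous on $\mathbb{R}^n$: there is a (nonrandom) $\gamma\in(0,1]$ such that $\mathbb P$-a.s., for every compact $K\subset\mathbb{R}^n$ there is a finite (random) constant $C$ with $|G^\alpha\mu_{X+\varphi}(x)-G^\alpha\mu_{X+\varphi}(y)|\le C|x-y|^\gamma$ for all $x,y\in K$. -/

import Mathlib

open MeasureTheory ProbabilityTheory Set
open scoped ENNReal NNReal

/-- The unit cube `[0,1]^k`, as a subset of Euclidean space. It carries the Euclidean distance and,
as a subtype, Lebesgue measure. -/
def unitCube (k : ℕ) : Set (EuclideanSpace ℝ (Fin k)) :=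
  {t | ∀ i, t i ∈ Icc (0 : ℝ) 1}

/-- Lebesgue measure `𝓛^k` on the unit cube. -/
noncomputable instance unitCube.instMeasureSpace (k : ℕ) : MeasureSpace (unitCube k) :=
  Measure.Subtype.measureSpace

/-- The corner `0` of the unit cube. -/
def cubeOrigin (k : ℕ) : unitCube k :=
  ⟨0, fun _ => ⟨le_rfl, zero_le_one⟩⟩

/-- The occupation measure `μ_Y(B) = 𝓛^k {t ∈ [0,1]^k | Y t ∈ B}` of a Borel function `Y`. -/
noncomputable def occupationMeasure {k n : ℕ} (Y : unitCube k → EuclideanSpace ℝ (Fin n)) :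
    Measure (EuclideanSpace ℝ (Fin n)) :=
  (volume : Measure (unitCube k)).map Y

/-- The Bessel kernel of order `α` on `ℝ^n`,
`g_α(x) = Γ(α/2)⁻¹ ∫_0^∞ s^(α/2-1) e^(-s) (4πs)^(-n/2) e^(-|x|²/(4s)) ds`,
with values in `[0,∞]` (for `0 < α ≤ n` one has `g_α(0) = ∞`). That its Fourier transform is
`(1 + |ξ|²)^(-α/2)` is proved in `charFun_besselKernel` below. -/
noncomputable def besselKernel {n : ℕ} (α : ℝ) (x : EuclideanSpace ℝ (Fin n)) : ℝ≥0∞ :=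
  ∫⁻ s in Ioi (0 : ℝ), ENNReal.ofReal
    (s ^ (α / 2 - 1) * Real.exp (-s) / Real.Gamma (α / 2) *
      ((4 * Real.pi * s) ^ (-(n : ℝ) / 2) * Real.exp (-‖x‖ ^ 2 / (4 * s))))

/-- The Bessel kernel is characterized by its Fourier transform
`∫ e^(i⟨x,ξ⟩) g_α(x) dx = (1 + |ξ|²)^(-α/2)`. -/
theorem charFun_besselKernel {n : ℕ} {α : ℝ} (hα : 0 < α) (ξ : EuclideanSpace ℝ (Fin n)) :
    charFun ((volume : Measure (EuclideanSpace ℝ (Fin n))).withDensity (besselKernel α)) ξ =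
      (((1 + ‖ξ‖ ^ 2) ^ (-α / 2) : ℝ) : ℂ) := by
  have hΓ : 0 < Real.Gamma (α / 2) := Real.Gamma_pos_of_pos (by positivity)
  -- the weight in `s` and the heat kernel
  set w : ℝ → ℝ := fun s => s ^ (α / 2 - 1) * Real.exp (-s) / Real.Gamma (α / 2) with hw
  set h : ℝ → EuclideanSpace ℝ (Fin n) → ℝ := fun s x =>
    (4 * Real.pi * s) ^ (-(n : ℝ) / 2) * Real.exp (-‖x‖ ^ 2 / (4 * s)) with hh
  have hw0 : ∀ s ∈ Ioi (0 : ℝ), 0 ≤ w s := fun s hs => by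
    have : (0 : ℝ) < s := hs
    simp only [hw]; positivity
  have hh0 : ∀ s ∈ Ioi (0 : ℝ), ∀ x, 0 ≤ h s x := fun s hs x => by
    have : (0 : ℝ) < s := hs
    simp only [hh]; positivity
  have hmeas : Measurable fun p : EuclideanSpace ℝ (Fin n) × ℝ => w p.2 * h p.2 p.1 := by
    simp only [hw, hh]; fun_prop
  have hg : ∀ x : EuclideanSpace ℝ (Fin n), besselKernel α x =
      ∫⁻ s in Ioi (0 : ℝ), ENNReal.ofReal (w s * h s x) := fun x => rfl
  have hgm : Measurable (besselKernel α : EuclideanSpace ℝ (Fin n) → ℝ≥0∞) := by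
    have := hmeas.ennreal_ofReal.lintegral_prod_right'
      (ν := (volume : Measure ℝ).restrict (Ioi 0))
    exact this
  -- the Fourier transform of the heat kernel
  have hheat : ∀ s ∈ Ioi (0 : ℝ), ∀ η : EuclideanSpace ℝ (Fin n),
      Integrable (fun x => (h s x : ℂ) * Complex.exp ((inner ℝ x η : ℝ) * Complex.I)) ∧
      ∫ x, (h s x : ℂ) * Complex.exp ((inner ℝ x η : ℝ) * Complex.I) =
        ((Real.exp (-(s * ‖η‖ ^ 2)) : ℝ) : ℂ) := by
    intro s hs η
    have hs' : (0 : ℝ) < s := hs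
    have hb : 0 < (((1 / (4 * s) : ℝ) : ℂ)).re := by
      rw [Complex.ofReal_re]; positivity
    have hfun : (fun x => (h s x : ℂ) * Complex.exp ((inner ℝ x η : ℝ) * Complex.I)) =
        fun x => (((4 * Real.pi * s) ^ (-(n : ℝ) / 2) : ℝ) : ℂ) *
          Complex.exp (-((1 / (4 * s) : ℝ) : ℂ) * (‖x‖ : ℂ) ^ 2 +
            Complex.I * (inner ℝ η x : ℝ)) := by
      funext x
      simp only [hh]
      rw [Complex.exp_add, real_inner_comm, mul_comm Complex.I]
      push_cast
      rw [mul_assoc]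
      congr 3
      field_simp
    rw [hfun]
    refine ⟨(GaussianFourier.integrable_cexp_neg_mul_sq_norm_add hb _ _).const_mul _, ?_⟩
    rw [integral_const_mul, GaussianFourier.integral_cexp_neg_mul_sq_norm_add hb]
    have h1 : ((Real.pi : ℂ) / ((1 / (4 * s) : ℝ) : ℂ)) ^
        ((Module.finrank ℝ (EuclideanSpace ℝ (Fin n)) : ℂ) / 2) =
        (((4 * Real.pi * s) ^ ((n : ℝ) / 2) : ℝ) : ℂ) := by
      rw [Complex.ofReal_cpow (by positivity), finrank_euclideanSpace_fin]
      push_cast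
      congr 1
      field_simp
    rw [h1, ← mul_assoc, ← Complex.ofReal_mul, neg_div, Real.rpow_neg (by positivity),
      inv_mul_cancel₀ (by positivity)]
    rw [Complex.I_sq]
    push_cast
    rw [one_mul]
    congr 1
    have : (s : ℂ) ≠ 0 := by exact_mod_cast hs'.ne'
    field_simp
  have hheat1 : ∀ s ∈ Ioi (0 : ℝ), Integrable (h s) ∧ ∫ x, h s x = 1 := by
    intro s hs
    obtain ⟨h1, h2⟩ := hheat s hs 0
    simp only [inner_zero_right, Complex.ofReal_zero, zero_mul, Complex.exp_zero, mul_one,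
      norm_zero, ne_eq, OfNat.ofNat_ne_zero, not_false_eq_true, zero_pow, mul_zero, neg_zero,
      Real.exp_zero] at h1 h2
    refine ⟨by simpa using h1.re, ?_⟩
    rw [integral_complex_ofReal] at h2
    exact_mod_cast h2
  have hwint : ∀ r : ℝ, 0 ≤ r →
      ∫ s in Ioi (0 : ℝ), w s * Real.exp (-(s * r)) = (1 + r) ^ (-α / 2) := by
    intro r hr
    have h1 : ∀ s : ℝ, w s * Real.exp (-(s * r)) =
        (Real.Gamma (α / 2))⁻¹ * (s ^ (α / 2 - 1) * Real.exp (-((1 + r) * s))) := by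
      intro s
      have : -((1 + r) * s) = -s + -(s * r) := by ring
      rw [this, Real.exp_add]
      simp only [hw]; ring
    simp_rw [h1]
    rw [integral_const_mul, Real.integral_rpow_mul_exp_neg_mul_Ioi (by positivity) (by positivity),
      one_div, Real.inv_rpow (by positivity), neg_div, Real.rpow_neg (by positivity)]
    field_simp
  have hwi : IntegrableOn w (Ioi 0) := by
    have := Real.GammaIntegral_convergent (s := α / 2) (by positivity)
    refine (this.div_const (Real.Gamma (α / 2))).congr ?_
    filter_upwards with s
    simp only [hw]; ring
  -- integrability on the product
  have hprod : Integrable (fun p : EuclideanSpace ℝ (Fin n) × ℝ => w p.2 * h p.2 p.1)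
      (volume.prod (volume.restrict (Ioi 0))) := by
    rw [integrable_prod_iff' hmeas.aestronglyMeasurable]
    constructor
    · filter_upwards [ae_restrict_mem measurableSet_Ioi] with s hs
      exact (hheat1 s hs).1.const_mul _
    · refine hwi.congr ?_
      filter_upwards [ae_restrict_mem measurableSet_Ioi] with s hs
      have : ∀ x, ‖w s * h s x‖ = w s * h s x := fun x =>
        Real.norm_of_nonneg (mul_nonneg (hw0 s hs) (hh0 s hs x))
      simp_rw [this]
      rw [integral_const_mul, (hheat1 s hs).2, mul_one]
  have hgr : ∀ x : EuclideanSpace ℝ (Fin n), (besselKernel α x).toReal =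
      ∫ s in Ioi (0 : ℝ), w s * h s x := by
    intro x
    rw [hg, integral_eq_lintegral_of_nonneg_ae]
    · filter_upwards [ae_restrict_mem measurableSet_Ioi] with s hs
      exact mul_nonneg (hw0 s hs) (hh0 s hs x)
    · exact (hmeas.comp (measurable_const.prodMk measurable_id)).aestronglyMeasurable
  have hgfin : ∀ᵐ x : EuclideanSpace ℝ (Fin n), besselKernel α x < ∞ := by
    filter_upwards [hprod.prod_right_ae] with x hx
    exact hx.lintegral_lt_top
  rw [charFun_apply, integral_withDensity_eq_integral_toReal_smul hgm hgfin]
  have h2 : ∀ x : EuclideanSpace ℝ (Fin n),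
      (besselKernel α x).toReal • Complex.exp ((inner ℝ x ξ : ℝ) * Complex.I) =
      ∫ s in Ioi (0 : ℝ), ((w s * h s x : ℝ) : ℂ) *
        Complex.exp ((inner ℝ x ξ : ℝ) * Complex.I) := by
    intro x
    rw [integral_mul_const, integral_complex_ofReal, hgr, Complex.real_smul]
  simp_rw [h2]
  rw [integral_integral_swap]
  · rw [← hwint (‖ξ‖ ^ 2) (by positivity), ← integral_complex_ofReal]
    refine setIntegral_congr_fun measurableSet_Ioi fun s hs => ?_
    simp only [Complex.ofReal_mul, mul_assoc]
    rw [integral_const_mul, (hheat s hs ξ).2]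
  · refine Integrable.mono hprod ?_ ?_
    · refine Measurable.aestronglyMeasurable ?_
      have hc : Measurable fun p : EuclideanSpace ℝ (Fin n) × ℝ => (w p.2 * h p.2 p.1 : ℂ) := by
        exact_mod_cast Complex.measurable_ofReal.comp hmeas
      simp only [Function.uncurry_def, Complex.ofReal_mul]
      exact hc.mul (by fun_prop)
    · filter_upwards with p
      simp only [Function.uncurry]
      rw [norm_mul, Complex.norm_exp_ofReal_mul_I, mul_one, Complex.norm_real]

/-- The Bessel potential `G_α μ (x) = ∫ g_α(x - y) μ(dy)`, with values in `[0,∞]`. -/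
noncomputable def besselPotential {n : ℕ} (α : ℝ) (μ : Measure (EuclideanSpace ℝ (Fin n)))
    (x : EuclideanSpace ℝ (Fin n)) : ℝ≥0∞ :=
  ∫⁻ y, besselKernel α (x - y) ∂μ

/-- `f` is locally Hölder continuous of order `γ`: Hölder of order `γ` on every compact set. -/
def LocallyHolder {n : ℕ} (γ : ℝ≥0) (f : EuclideanSpace ℝ (Fin n) → ℝ) : Prop :=
  ∀ K : Set (EuclideanSpace ℝ (Fin n)), IsCompact K → ∃ C : ℝ≥0, HolderOnWith C γ f K

section RandomFields

variable {k n : ℕ} {Ω : Type*} [MeasurableSpace Ω]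

/-- The covariance matrix `σ²(s,t)` of the increment `X(t) - X(s)`. -/
noncomputable def incrementCov (X : unitCube k → Ω → EuclideanSpace ℝ (Fin n)) (P : Measure Ω)
    (s t : unitCube k) : Matrix (Fin n) (Fin n) ℝ :=
  Matrix.of fun i j =>
    covariance (fun ω => (X t ω - X s ω) i) (fun ω => (X t ω - X s ω) j) P

/-- The points `t_0, t_1, …, t_ℓ` with `t_0 = 0`, for given `t = (t_1, …, t_ℓ)`. -/
def withOrigin {ℓ : ℕ} (t : Fin ℓ → unitCube k) : Fin (ℓ + 1) → unitCube k :=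
  Fin.cons (cubeOrigin k) t

/-- The tuples `(t_1, …, t_ℓ)` at which local nondeterminism is tested: with `t_0 = 0`, all of
`t_1, …, t_ℓ` lie in a common closed axis-parallel cube of side length `ε`, and
`|t_{j+1} - t_j| ≤ |t_{j+1} - t_i|` for `0 ≤ i ≤ j < ℓ`, i.e. each point has its predecessor as a
nearest neighbour among the earlier points. (For `ε ≤ 1` the cube can be shifted into
`[0,1]^k`.) -/
def LNDAdmissible {ℓ : ℕ} (ε : ℝ) (t : Fin ℓ → unitCube k) : Prop :=
  (∃ a : EuclideanSpace ℝ (Fin k), ∀ (j : Fin ℓ) (m : Fin k),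
      (t j : EuclideanSpace ℝ (Fin k)) m ∈ Icc (a m) (a m + ε)) ∧
    ∀ i j : Fin ℓ, i ≤ j →
      dist (withOrigin t j.succ) (withOrigin t j.castSucc) ≤
        dist (withOrigin t j.succ) (withOrigin t i.castSucc)

/-- Local nondeterminism of `X`: for every `ℓ ≥ 2` there are `c, ε > 0` such that for a.e.
admissible tuple `(t_1, …, t_ℓ)`, with `t_0 = 0` and `σ_j` a root (`σ_j σ_jᵀ = σ_j²`) of the
covariance matrix `σ_j²` of `X(t_j) - X(t_{j-1})`,
`Var (∑_j ⟨u_j, σ_j⁻¹ (X(t_j) - X(t_{j-1}))⟩) ≥ c ∑_j |u_j|²` for all `u_1, …, u_ℓ`.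
(The choice of the root is immaterial: two invertible roots differ by an orthogonal matrix. If
`n ≥ 1`, the inequality forces every `σ_j` to be invertible, since a noninvertible matrix has
inverse `0` here.) -/
def LocallyNondeterministic (X : unitCube k → Ω → EuclideanSpace ℝ (Fin n))
    (P : Measure Ω) : Prop :=
  ∀ ℓ : ℕ, 2 ≤ ℓ → ∃ c > 0, ∃ ε > 0, ∀ᵐ t : Fin ℓ → unitCube k, LNDAdmissible ε t →
    ∃ σ : Fin ℓ → Matrix (Fin n) (Fin n) ℝ,
      (∀ j, σ j * (σ j).transpose =
        incrementCov X P (withOrigin t j.castSucc) (withOrigin t j.succ)) ∧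
      ∀ u : Fin ℓ → EuclideanSpace ℝ (Fin n),
        c * ∑ j, ‖u j‖ ^ 2 ≤
          variance (fun ω => ∑ j, inner ℝ (u j) (Matrix.toEuclideanLin (σ j)⁻¹
            (X (withOrigin t j.succ) ω - X (withOrigin t j.castSucc) ω))) P

end RandomFields

/-! A finite measure on `ℝ^n` whose balls satisfy `μ (B(x,r)) ≤ C r ^ β` uniformly in `x`, for some
`β > n - α`, has a Hölder continuous Bessel potential, with an exponent depending only on `α`, `β`,
`n` (`exists_locallyHolder_besselPotential`). It therefore suffices to prove such ball growth almost
surely for the occupation measure, with nonrandom `β`.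

The growth comes from moments. The `(p+1)`-st power of the time spent in `B(x,r)` is at most the
volume of the `(p+1)`-tuples whose values are mutually `2r`-close, a quantity free of `x`; one
expectation thus controls all centres at once, without continuity of `X` or `φ`. To bound it, order
each tuple so that every point has its predecessor as a nearest neighbour among the earlier ones.
Local nondeterminism then makes the `p` increments behave as if independent: their joint small ball
probability is at most a product of factors `C r ^ b |det σ²| ^ (-a)` with `b = 2na`
(`measureReal_forall_norm_sub_le`, `LocallyNondeterministic.measure_increments_le`). The drift only
recentres the balls. Integration along the chain costs one factor `K` per step, by the covariance
hypothesis (`lintegral_volume_closeTuples_le`).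

The result is `r ^ (p * b)` for a moment of order `p + 1`; since `b > n - α`, a large `p` leaves
room for some `β > n - α` with `(p + 1) * β < p * b`, and the dyadic radii become summable. Because
the chain conditions include `t_0 = 0`, this is done on small pieces away from the origin
(`exists_cover_isOffOrigin`), whose volumes decay fast enough to sum the contributions
(`ae_exists_occupationMeasure_closedBall_le`). -/

/-! ### Hölder comparison of Gaussians at two points -/

/-- The Gaussian profile `exp (-u² / 2)` is `1`-Lipschitz. -/
theorem abs_exp_neg_sq_half_sub_le (u v : ℝ) :
    |Real.exp (-u ^ 2 / 2) - Real.exp (-v ^ 2 / 2)| ≤ |u - v| := by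
  have hd : ∀ x : ℝ, HasDerivAt (fun u : ℝ => Real.exp (-u ^ 2 / 2))
      (Real.exp (-x ^ 2 / 2) * (-x)) x := by
    intro x
    have h1 : HasDerivAt (fun u : ℝ => -u ^ 2 / 2) (-x) x := by
      exact ((hasDerivAt_pow 2 x).fun_neg.div_const 2).congr_deriv (by norm_num; ring)
    exact h1.exp
  have hb : ∀ x : ℝ, ‖Real.exp (-x ^ 2 / 2) * (-x)‖ ≤ 1 := by
    intro x
    rw [norm_mul, norm_neg, Real.norm_eq_abs, Real.norm_eq_abs, abs_of_pos (Real.exp_pos _)]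
    have h1 : |x| ≤ Real.exp (x ^ 2 / 2) := by
      have h2 := Real.add_one_le_exp (x ^ 2 / 2)
      have h3 : x ^ 2 = |x| ^ 2 := (sq_abs x).symm
      nlinarith [sq_nonneg (|x| - 1)]
    calc Real.exp (-x ^ 2 / 2) * |x| ≤ Real.exp (-x ^ 2 / 2) * Real.exp (x ^ 2 / 2) := by gcongr
      _ = 1 := by rw [← Real.exp_add]; ring_nf; simp
  have := Convex.norm_image_sub_le_of_norm_hasDerivWithin_le (s := univ)
    (fun x _ => (hd x).hasDerivWithinAt) (fun x _ => hb x) convex_univ (mem_univ v) (mem_univ u)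
  simpa using this

/-- Factor `a² - b² = (a - b)(a + b)` with `a`, `b` the Gaussians of halved exponent. The difference
`a - b` is at most both `1` and `|u - v|`, hence at most `|u - v| ^ γ`, while `a + b` keeps Gaussian
decay. -/
theorem exp_neg_sq_le_add {γ : ℝ} (h0 : 0 ≤ γ) (h1 : γ ≤ 1) (u v : ℝ) :
    Real.exp (-u ^ 2) ≤ Real.exp (-v ^ 2) +
      |u - v| ^ γ * (Real.exp (-u ^ 2 / 2) + Real.exp (-v ^ 2 / 2)) := by
  set a := Real.exp (-u ^ 2 / 2) with ha
  set b := Real.exp (-v ^ 2 / 2) with hb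
  have hu : Real.exp (-u ^ 2) = a ^ 2 := by rw [ha, ← Real.exp_nat_mul]; congr 1; push_cast; ring
  have hv : Real.exp (-v ^ 2) = b ^ 2 := by rw [hb, ← Real.exp_nat_mul]; congr 1; push_cast; ring
  have ha0 : 0 < a := Real.exp_pos _
  have hb0 : 0 < b := Real.exp_pos _
  have ha1 : a ≤ 1 := Real.exp_le_one_iff.2 (by nlinarith [sq_nonneg u])
  have hd : a - b ≤ |u - v| ^ γ := by
    rcases le_total 1 |u - v| with h | h
    · linarith [Real.one_le_rpow h h0]
    · rcases eq_or_lt_of_le (abs_nonneg (u - v)) with h' | h'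
      · have := abs_exp_neg_sq_half_sub_le u v
        have h2 := le_abs_self (a - b)
        have h3 := Real.rpow_nonneg (abs_nonneg (u - v)) γ
        simp only [← ha, ← hb] at this
        linarith
      · calc a - b ≤ |u - v| := (le_abs_self _).trans (abs_exp_neg_sq_half_sub_le u v)
          _ = |u - v| ^ (1 : ℝ) := (Real.rpow_one _).symm
          _ ≤ |u - v| ^ γ := Real.rpow_le_rpow_of_exponent_ge h' h h1
  rw [hu, hv]
  nlinarith

/-- Comparison of the heat kernel at two points. -/
theorem exp_neg_norm_sq_le_add {E : Type*} [NormedAddCommGroup E] {γ : ℝ} (h0 : 0 ≤ γ)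
    (h1 : γ ≤ 1) {s : ℝ} (hs : 0 < s) (a b : E) :
    Real.exp (-‖a‖ ^ 2 / (4 * s)) ≤ Real.exp (-‖b‖ ^ 2 / (4 * s)) +
      ‖a - b‖ ^ γ * (s ^ (-γ / 2) *
        (Real.exp (-‖a‖ ^ 2 / (8 * s)) + Real.exp (-‖b‖ ^ 2 / (8 * s)))) := by
  have hq : 0 < √s := Real.sqrt_pos.2 hs
  have hq2 : √s ^ 2 = s := Real.sq_sqrt hs.le
  have key := exp_neg_sq_le_add h0 h1 (‖a‖ / (2 * √s)) (‖b‖ / (2 * √s))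
  have e1 : ∀ z : ℝ, -(z / (2 * √s)) ^ 2 = -z ^ 2 / (4 * s) := by
    intro z; rw [div_pow, mul_pow, hq2]; ring
  have e2 : ∀ z : ℝ, -z ^ 2 / (4 * s) / 2 = -z ^ 2 / (8 * s) := by
    intro z; field_simp; ring
  rw [e1, e1, e2, e2] at key
  refine key.trans ?_
  rw [← mul_assoc]
  gcongr
  have h2 : |‖a‖ / (2 * √s) - ‖b‖ / (2 * √s)| ≤ ‖a - b‖ * s ^ (-(1 / 2) : ℝ) := by
    rw [← sub_div, abs_div, abs_of_pos (by positivity : 0 < 2 * √s), Real.rpow_neg hs.le,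
      ← Real.sqrt_eq_rpow, ← div_eq_mul_inv]
    gcongr
    · exact abs_norm_sub_norm_le a b
    · linarith
  calc |‖a‖ / (2 * √s) - ‖b‖ / (2 * √s)| ^ γ ≤ (‖a - b‖ * s ^ (-(1 / 2) : ℝ)) ^ γ := by
        gcongr
    _ = ‖a - b‖ ^ γ * s ^ (-γ / 2) := by
        rw [Real.mul_rpow (norm_nonneg _) (by positivity), ← Real.rpow_mul hs.le]
        congr 2; ring

theorem tsum_exp_neg_mul_rpow_lt_top (q : ℝ) :
    ∑' j : ℕ, ENNReal.ofReal (Real.exp (-j) * ((j : ℝ) + 1) ^ q) < ∞ := by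
  have hs : Summable fun j : ℕ => Real.exp (-j) * ((j : ℝ) + 1) ^ q := by
    obtain ⟨N, hN⟩ := exists_nat_ge q
    have h1 := (summable_nat_add_iff 1).2
      (Real.summable_pow_mul_exp_neg_nat_mul N (zero_lt_one' ℝ))
    refine Summable.of_nonneg_of_le (fun j => by positivity) (fun j => ?_)
      (h1.mul_left (Real.exp 1))
    have h2 : ((j : ℝ) + 1) ^ q ≤ ((j : ℝ) + 1) ^ N := by
      rw [← Real.rpow_natCast]
      exact Real.rpow_le_rpow_of_exponent_le (by linarith [j.cast_nonneg (α := ℝ)]) hN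
    have h3 : Real.exp (-j) = Real.exp 1 * Real.exp (-1 * ((j + 1 : ℕ) : ℝ)) := by
      rw [← Real.exp_add]; congr 1; push_cast; ring
    rw [h3]
    push_cast
    have : (0 : ℝ) < Real.exp 1 * Real.exp (-1 * ((j : ℝ) + 1)) := by positivity
    nlinarith
  rw [← ENNReal.ofReal_tsum_of_nonneg (fun j => by positivity) hs]
  exact ENNReal.ofReal_lt_top

/-! ### Gaussian averages under a ball growth condition -/

section Frostman

variable {E : Type*} [NormedAddCommGroup E] [MeasurableSpace E] [BorelSpace E]

/-- Gaussian averages of a measure with polynomial ball growth. -/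
theorem lintegral_exp_neg_norm_sq_le {β : ℝ} {μ : Measure E} {C : ℝ≥0∞}
    (hμ : ∀ x : E, ∀ r : ℝ, 0 < r → μ (Metric.closedBall x r) ≤ C * ENNReal.ofReal (r ^ β))
    {l : ℝ} (hl : 0 < l) (x : E) :
    ∫⁻ y, ENNReal.ofReal (Real.exp (-‖x - y‖ ^ 2 / l)) ∂μ ≤
      C * (∑' j : ℕ, ENNReal.ofReal (Real.exp (-j) * ((j : ℝ) + 1) ^ (β / 2))) *
        ENNReal.ofReal (l ^ (β / 2)) := by
  -- Where `‖x - y‖² / l` lies in `[j, j + 1)`, the Gaussian is at most `exp (-j)` and `y` lies in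
  -- the ball of radius `R j`.
  set R : ℕ → ℝ := fun j => √(l * ((j : ℝ) + 1)) with hR
  have hR0 : ∀ j, 0 < R j := fun j => Real.sqrt_pos.2 (by positivity)
  have hpt : ∀ y, ENNReal.ofReal (Real.exp (-‖x - y‖ ^ 2 / l)) ≤
      ∑' j : ℕ, (Metric.closedBall x (R j)).indicator
        (fun _ => ENNReal.ofReal (Real.exp (-j))) y := by
    intro y
    set v := ‖x - y‖ ^ 2 / l with hv
    have hv0 : 0 ≤ v := by positivity
    refine le_trans ?_ (ENNReal.le_tsum ⌊v⌋₊)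
    have hmem : y ∈ Metric.closedBall x (R ⌊v⌋₊) := by
      rw [Metric.mem_closedBall, dist_comm, dist_eq_norm]
      refine Real.le_sqrt_of_sq_le ?_
      have h1 := (Nat.lt_floor_add_one v).le
      rw [hv, div_le_iff₀ hl] at h1
      linarith
    rw [indicator_of_mem hmem]
    refine ENNReal.ofReal_le_ofReal (Real.exp_le_exp.2 ?_)
    rw [neg_div]
    exact neg_le_neg (Nat.floor_le hv0)
  calc ∫⁻ y, ENNReal.ofReal (Real.exp (-‖x - y‖ ^ 2 / l)) ∂μ
      ≤ ∫⁻ y, ∑' j : ℕ, (Metric.closedBall x (R j)).indicator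
        (fun _ => ENNReal.ofReal (Real.exp (-j))) y ∂μ := lintegral_mono hpt
    _ = ∑' j : ℕ, ENNReal.ofReal (Real.exp (-j)) * μ (Metric.closedBall x (R j)) := by
        rw [lintegral_tsum fun j =>
          (measurable_const.indicator Metric.isClosed_closedBall.measurableSet).aemeasurable]
        congr 1; ext j
        rw [lintegral_indicator_const Metric.isClosed_closedBall.measurableSet]
    _ ≤ ∑' j : ℕ, C * ENNReal.ofReal (Real.exp (-j) * ((j : ℝ) + 1) ^ (β / 2)) *
          ENNReal.ofReal (l ^ (β / 2)) := by
        refine ENNReal.tsum_le_tsum fun j => ?_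
        have h1 : R j ^ β = l ^ (β / 2) * ((j : ℝ) + 1) ^ (β / 2) := by
          simp only [hR]
          rw [Real.sqrt_eq_rpow, ← Real.rpow_mul (by positivity),
            Real.mul_rpow hl.le (by positivity)]
          congr 2 <;> ring
        calc _ ≤ ENNReal.ofReal (Real.exp (-j)) * (C * ENNReal.ofReal (R j ^ β)) := by
              gcongr; exact hμ x _ (hR0 j)
          _ = _ := by
              rw [h1, ENNReal.ofReal_mul (by positivity), ENNReal.ofReal_mul (by positivity)]
              ring
    _ = _ := by rw [ENNReal.tsum_mul_right, ENNReal.tsum_mul_left]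

end Frostman

/-! ### Bessel potentials of measures with ball growth -/

section Potential

variable {n : ℕ} {α : ℝ}

/-- The weight of the heat kernel at time `s` in the Bessel kernel, including the normalization of
the heat kernel. -/
noncomputable def besselWeight (n : ℕ) (α s : ℝ) : ℝ :=
  s ^ (α / 2 - 1) * Real.exp (-s) / Real.Gamma (α / 2) * (4 * Real.pi * s) ^ (-(n : ℝ) / 2)

theorem besselWeight_nonneg (hα : 0 < α) {s : ℝ} (hs : 0 < s) : 0 ≤ besselWeight n α s := by
  have := Real.Gamma_pos_of_pos (half_pos hα)
  unfold besselWeight; positivity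

theorem measurable_besselWeight : Measurable (besselWeight n α) := by
  unfold besselWeight; fun_prop

/-- Up to a constant this is the Gamma integral at `α / 2 + q - n / 2`, so the hypothesis is exactly
positivity of that argument. -/
theorem lintegral_besselWeight_mul_rpow_lt_top {q : ℝ} (hq : n < α + 2 * q) :
    ∫⁻ s in Ioi (0 : ℝ), ENNReal.ofReal (besselWeight n α s * s ^ q) < ∞ := by
  have h1 := Real.GammaIntegral_convergent (s := α / 2 + q - n / 2) (by linarith)
  have h2 : IntegrableOn (fun s => besselWeight n α s * s ^ q) (Ioi 0) := by
    refine (h1.const_mul ((4 * Real.pi) ^ (-(n : ℝ) / 2) / Real.Gamma (α / 2))).congr ?_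
    filter_upwards [ae_restrict_mem measurableSet_Ioi] with s hs
    have hs' : (0 : ℝ) < s := hs
    unfold besselWeight
    rw [Real.mul_rpow (by positivity) hs'.le]
    have : s ^ (α / 2 + q - n / 2 - 1) = s ^ (α / 2 - 1) * s ^ (-(n : ℝ) / 2) * s ^ q := by
      rw [← Real.rpow_add hs', ← Real.rpow_add hs']; congr 1; ring
    rw [this]; ring
  exact h2.lintegral_lt_top

/-- By Tonelli the potential is a weighted superposition of Gaussian averages, so estimates can be
made for each `s` separately. -/
theorem besselPotential_eq (hα : 0 < α) (μ : Measure (EuclideanSpace ℝ (Fin n))) [SFinite μ]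
    (x : EuclideanSpace ℝ (Fin n)) :
    besselPotential α μ x = ∫⁻ s in Ioi (0 : ℝ), ENNReal.ofReal (besselWeight n α s) *
      ∫⁻ y, ENNReal.ofReal (Real.exp (-‖x - y‖ ^ 2 / (4 * s))) ∂μ := by
  unfold besselPotential besselKernel
  rw [lintegral_lintegral_swap]
  · refine setLIntegral_congr_fun measurableSet_Ioi fun s hs => ?_
    rw [← lintegral_const_mul _ (by fun_prop)]
    refine lintegral_congr fun y => ?_
    rw [← ENNReal.ofReal_mul (besselWeight_nonneg hα hs)]
    congr 1
    unfold besselWeight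
    ring
  · refine Measurable.aemeasurable ?_
    simp only [Function.uncurry_def]
    fun_prop

/-- An s-finite measure with `μ (B(x,r)) ≤ C r ^ β`, `β > n - α`, has a finite and (uniformly) Hölder
continuous Bessel potential of order `α`, with an exponent that depends only on `α, β, n`. -/
theorem exists_locallyHolder_besselPotential (hα : 0 < α) {β : ℝ} (hβ : n < α + β) :
    ∃ γ : ℝ≥0, 0 < γ ∧ γ ≤ 1 ∧ ∀ (μ : Measure (EuclideanSpace ℝ (Fin n))) [SFinite μ] (C : ℝ≥0∞),
      C ≠ ∞ → (∀ x, ∀ r : ℝ, 0 < r → μ (Metric.closedBall x r) ≤ C * ENNReal.ofReal (r ^ β)) →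
      (∀ x, besselPotential α μ x < ∞) ∧
        LocallyHolder γ (fun x => (besselPotential α μ x).toReal) := by
  -- An increment of order `κ` costs `s ^ (-κ / 2)` in the weight; taking at most half of the gap `α
  -- + β - n` keeps the integral near `s = 0` finite.
  set κ : ℝ := min 1 ((α + β - n) / 2) with hκ
  have hκ0 : 0 < κ := lt_min one_pos (by linarith)
  have hκ1 : κ ≤ 1 := min_le_left _ _
  have hκ2 : κ ≤ (α + β - n) / 2 := min_le_right _ _
  refine ⟨⟨κ, hκ0.le⟩, hκ0, hκ1, fun μ _ C hC hμ => ?_⟩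
  set K : ℝ≥0∞ := ∑' j : ℕ, ENNReal.ofReal (Real.exp (-j) * ((j : ℝ) + 1) ^ (β / 2)) with hK
  have hKt : K < ∞ := tsum_exp_neg_mul_rpow_lt_top _
  -- Used with `g = 0`, `b = 4` for finiteness and with `g = κ`, `b = 8` for the Hölder bound.
  have hbound : ∀ g : ℝ, 0 ≤ g → n < α + β - g → ∀ b : ℝ, 0 < b →
      ∃ D : ℝ≥0, ∀ x, ∫⁻ s in Ioi (0 : ℝ), ENNReal.ofReal (besselWeight n α s) *
        (ENNReal.ofReal (s ^ (-g / 2)) *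
          ∫⁻ y, ENNReal.ofReal (Real.exp (-‖x - y‖ ^ 2 / (b * s))) ∂μ) ≤ D := by
    intro g hg hg' b hb
    have hfin := lintegral_besselWeight_mul_rpow_lt_top (n := n) (α := α)
      (q := β / 2 - g / 2) (by linarith)
    refine ⟨(C * K * ENNReal.ofReal (b ^ (β / 2)) * ∫⁻ s in Ioi (0 : ℝ),
      ENNReal.ofReal (besselWeight n α s * s ^ (β / 2 - g / 2))).toNNReal, fun x => ?_⟩
    rw [ENNReal.coe_toNNReal (ENNReal.mul_ne_top (ENNReal.mul_ne_top
      (ENNReal.mul_ne_top hC hKt.ne) ENNReal.ofReal_ne_top) hfin.ne)]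
    have hwm : Measurable fun s =>
        ENNReal.ofReal (besselWeight n α s * s ^ (β / 2 - g / 2)) :=
      (measurable_besselWeight.mul (measurable_id.pow_const _)).ennreal_ofReal
    rw [← lintegral_const_mul _ hwm]
    refine setLIntegral_mono' measurableSet_Ioi fun s hs => ?_
    have hs' : (0 : ℝ) < s := hs
    calc _ ≤ ENNReal.ofReal (besselWeight n α s) * (ENNReal.ofReal (s ^ (-g / 2)) *
          (C * K * ENNReal.ofReal ((b * s) ^ (β / 2)))) := by
          gcongr
          exact lintegral_exp_neg_norm_sq_le hμ (by positivity) x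
      _ = _ := by
          have : s ^ (β / 2 - g / 2) = s ^ (β / 2) * s ^ (-g / 2) := by
            rw [← Real.rpow_add hs']; congr 1; ring
          rw [this, ENNReal.ofReal_mul (besselWeight_nonneg hα hs'),
            ENNReal.ofReal_mul (by positivity), Real.mul_rpow hb.le hs'.le,
            ENNReal.ofReal_mul (by positivity)]
          ring
  have hfin : ∀ x, besselPotential α μ x < ∞ := by
    obtain ⟨D, hD⟩ := hbound 0 le_rfl (by linarith) 4 (by norm_num)
    intro x
    rw [besselPotential_eq hα]
    refine lt_of_le_of_lt ?_ (ENNReal.coe_lt_top (r := D))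
    simpa using hD x
  refine ⟨hfin, ?_⟩
  obtain ⟨D, hD⟩ := hbound κ hκ0.le (by linarith) 8 (by norm_num)
  have hle : ∀ x x', besselPotential α μ x ≤
      besselPotential α μ x' + ENNReal.ofReal (‖x - x'‖ ^ κ) * (D + D) := by
    intro x x'
    have hinner : ∀ s ∈ Ioi (0 : ℝ),
        ENNReal.ofReal (besselWeight n α s) *
          ∫⁻ y, ENNReal.ofReal (Real.exp (-‖x - y‖ ^ 2 / (4 * s))) ∂μ ≤
        ENNReal.ofReal (besselWeight n α s) *
          (∫⁻ y, ENNReal.ofReal (Real.exp (-‖x' - y‖ ^ 2 / (4 * s))) ∂μ) +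
        ENNReal.ofReal (‖x - x'‖ ^ κ) *
          (ENNReal.ofReal (besselWeight n α s) * (ENNReal.ofReal (s ^ (-κ / 2)) *
            ∫⁻ y, ENNReal.ofReal (Real.exp (-‖x - y‖ ^ 2 / (8 * s))) ∂μ) +
          ENNReal.ofReal (besselWeight n α s) * (ENNReal.ofReal (s ^ (-κ / 2)) *
            ∫⁻ y, ENNReal.ofReal (Real.exp (-‖x' - y‖ ^ 2 / (8 * s))) ∂μ)) := by
      intro s hs
      have hs' : (0 : ℝ) < s := hs
      have h1 : ∫⁻ y, ENNReal.ofReal (Real.exp (-‖x - y‖ ^ 2 / (4 * s))) ∂μ ≤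
          (∫⁻ y, ENNReal.ofReal (Real.exp (-‖x' - y‖ ^ 2 / (4 * s))) ∂μ) +
          ENNReal.ofReal (‖x - x'‖ ^ κ) * (ENNReal.ofReal (s ^ (-κ / 2)) *
            ((∫⁻ y, ENNReal.ofReal (Real.exp (-‖x - y‖ ^ 2 / (8 * s))) ∂μ) +
            ∫⁻ y, ENNReal.ofReal (Real.exp (-‖x' - y‖ ^ 2 / (8 * s))) ∂μ)) := by
        rw [← lintegral_add_left (by fun_prop), ← lintegral_const_mul _ (by fun_prop),
          ← lintegral_const_mul _ (by fun_prop), ← lintegral_add_left (by fun_prop)]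
        refine lintegral_mono fun y => ?_
        have h2 := exp_neg_norm_sq_le_add hκ0.le hκ1 hs' (x - y) (x' - y)
        rw [sub_sub_sub_cancel_right] at h2
        rw [← ENNReal.ofReal_add (by positivity) (by positivity),
          ← ENNReal.ofReal_mul (by positivity), ← ENNReal.ofReal_mul (by positivity),
          ← ENNReal.ofReal_add (by positivity) (by positivity)]
        exact ENNReal.ofReal_le_ofReal h2
      refine (mul_le_mul_right h1 _).trans (le_of_eq ?_)
      simp only [mul_add, mul_left_comm]
    have hm : ∀ (b : ℝ) (z : EuclideanSpace ℝ (Fin n)), Measurable fun s : ℝ =>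
        ∫⁻ y, ENNReal.ofReal (Real.exp (-‖z - y‖ ^ 2 / (b * s))) ∂μ := by
      intro b z
      refine Measurable.lintegral_prod_right'
        (f := fun p : ℝ × EuclideanSpace ℝ (Fin n) =>
          ENNReal.ofReal (Real.exp (-‖z - p.2‖ ^ 2 / (b * p.1)))) ?_
      fun_prop
    have hwm := (measurable_besselWeight (n := n) (α := α)).ennreal_ofReal
    rw [besselPotential_eq hα, besselPotential_eq hα]
    have hm1 : ∀ z, Measurable fun s : ℝ => ENNReal.ofReal (besselWeight n α s) *
        (ENNReal.ofReal (s ^ (-κ / 2)) *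
          ∫⁻ y, ENNReal.ofReal (Real.exp (-‖z - y‖ ^ 2 / (8 * s))) ∂μ) := fun z =>
      hwm.mul (Measurable.mul (by fun_prop) (hm 8 z))
    refine (setLIntegral_mono' measurableSet_Ioi hinner).trans ?_
    have hm0 : Measurable fun s : ℝ => ENNReal.ofReal (besselWeight n α s) *
        ∫⁻ y, ENNReal.ofReal (Real.exp (-‖x' - y‖ ^ 2 / (4 * s))) ∂μ := hwm.mul (hm 4 x')
    have hm2 := (hm1 x).fun_add (hm1 x')
    rw [lintegral_add_left hm0, lintegral_const_mul _ hm2,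
      lintegral_add_left (hm1 x)]
    gcongr
    · exact hD x
    · exact hD x'
  intro S _
  refine ⟨D + D, fun x _ y _ => ?_⟩
  have hnorm : edist x y ^ κ = ENNReal.ofReal (‖x - y‖ ^ κ) := by
    rw [edist_dist, dist_eq_norm, ENNReal.ofReal_rpow_of_nonneg (norm_nonneg _) hκ0.le]
  have h1 := hle x y
  have h2 := hle y x
  rw [norm_sub_rev] at h2
  change edist _ _ ≤ _ * edist x y ^ κ
  rw [hnorm, mul_comm, ENNReal.coe_add]
  set T : ℝ≥0∞ := ENNReal.ofReal (‖x - y‖ ^ κ) * (D + D) with hT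
  have hTt : T ≠ ∞ := ENNReal.mul_ne_top ENNReal.ofReal_ne_top (by simp)
  rw [edist_dist, Real.dist_eq, ← ENNReal.ofReal_toReal hTt]
  refine ENNReal.ofReal_le_ofReal (abs_sub_le_iff.2 ⟨?_, ?_⟩)
  · have := ENNReal.toReal_mono (ENNReal.add_ne_top.2 ⟨(hfin y).ne, hTt⟩) h1
    rw [ENNReal.toReal_add (hfin y).ne hTt] at this
    linarith
  · have := ENNReal.toReal_mono (ENNReal.add_ne_top.2 ⟨(hfin x).ne, hTt⟩) h2
    rw [ENNReal.toReal_add (hfin x).ne hTt] at this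
    linarith

end Potential

/-! ### Small ball estimates for Gaussian vectors -/

section GaussianEstimates

variable {n : ℕ}

/-- Both sides have the same characteristic function. The density is what permits a linear change of
variables below. -/
theorem stdGaussian_eq_withDensity : stdGaussian (EuclideanSpace ℝ (Fin n)) =
    (volume : Measure (EuclideanSpace ℝ (Fin n))).withDensity fun x =>
      ENNReal.ofReal ((2 * Real.pi) ^ (-(n : ℝ) / 2) * Real.exp (-‖x‖ ^ 2 / 2)) := by
  set d : EuclideanSpace ℝ (Fin n) → ℝ := fun x =>
    (2 * Real.pi) ^ (-(n : ℝ) / 2) * Real.exp (-‖x‖ ^ 2 / 2) with hd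
  have hd0 : ∀ x, 0 ≤ d x := fun x => by simp only [hd]; positivity
  have hdm : Measurable d := by simp only [hd]; fun_prop
  have hb : 0 < (((1 / 2 : ℝ) : ℂ)).re := by rw [Complex.ofReal_re]; norm_num
  have hfun : ∀ t : EuclideanSpace ℝ (Fin n),
      (fun x => (d x : ℂ) * Complex.exp ((inner ℝ x t : ℝ) * Complex.I)) =
      fun x => (((2 * Real.pi) ^ (-(n : ℝ) / 2) : ℝ) : ℂ) *
        Complex.exp (-((1 / 2 : ℝ) : ℂ) * (‖x‖ : ℂ) ^ 2 + Complex.I * (inner ℝ t x : ℝ)) := by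
    intro t
    funext x
    simp only [hd]
    rw [Complex.exp_add, real_inner_comm, mul_comm Complex.I]
    push_cast
    rw [mul_assoc]
    congr 3
    ring
  have hint : ∀ t : EuclideanSpace ℝ (Fin n),
      Integrable (fun x => (d x : ℂ) * Complex.exp ((inner ℝ x t : ℝ) * Complex.I)) := by
    intro t
    rw [hfun]
    exact (GaussianFourier.integrable_cexp_neg_mul_sq_norm_add hb _ _).const_mul _
  have hdi : Integrable d := by
    have := (hint 0).re
    simpa using this
  have : IsFiniteMeasure ((volume : Measure (EuclideanSpace ℝ (Fin n))).withDensity fun x =>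
      ENNReal.ofReal (d x)) := isFiniteMeasure_withDensity_ofReal hdi.2
  refine Measure.ext_of_charFun (funext fun t => ?_)
  rw [charFun_stdGaussian, charFun_apply,
    integral_withDensity_eq_integral_toReal_smul hdm.ennreal_ofReal
      (Filter.Eventually.of_forall fun _ => ENNReal.ofReal_lt_top)]
  simp_rw [ENNReal.toReal_ofReal (hd0 _), Complex.real_smul]
  rw [hfun, integral_const_mul, GaussianFourier.integral_cexp_neg_mul_sq_norm_add hb]
  have h1 : ((Real.pi : ℂ) / ((1 / 2 : ℝ) : ℂ)) ^
      ((Module.finrank ℝ (EuclideanSpace ℝ (Fin n)) : ℂ) / 2) =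
      (((2 * Real.pi) ^ ((n : ℝ) / 2) : ℝ) : ℂ) := by
    rw [Complex.ofReal_cpow (by positivity), finrank_euclideanSpace_fin]
    push_cast
    congr 1
    field_simp
  rw [h1, ← mul_assoc, ← Complex.ofReal_mul, neg_div (2 : ℝ), Real.rpow_neg (by positivity),
    inv_mul_cancel₀ (by positivity), Complex.I_sq]
  push_cast
  rw [one_mul]
  congr 1
  ring

theorem integrable_exp_neg_norm_sq_comp (μ : Measure (EuclideanSpace ℝ (Fin n)))
    [IsFiniteMeasure μ] (T : EuclideanSpace ℝ (Fin n) →ₗ[ℝ] EuclideanSpace ℝ (Fin n)) :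
    Integrable (fun g => Real.exp (-‖T g‖ ^ 2 / 2)) μ := by
  have hT : Measurable T := T.continuous_of_finiteDimensional.measurable
  refine Integrable.of_bound (C := 1) (by fun_prop) (ae_of_all _ fun g => ?_)
  rw [Real.norm_of_nonneg (Real.exp_pos _).le]
  exact Real.exp_le_one_iff.2 (by nlinarith [sq_nonneg ‖T g‖])

theorem integral_exp_neg_norm_sq_comp_le_one
    (T : EuclideanSpace ℝ (Fin n) →ₗ[ℝ] EuclideanSpace ℝ (Fin n)) :
    ∫ g, Real.exp (-‖T g‖ ^ 2 / 2) ∂stdGaussian (EuclideanSpace ℝ (Fin n)) ≤ 1 := by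
  calc _ ≤ ∫ _, (1 : ℝ) ∂stdGaussian (EuclideanSpace ℝ (Fin n)) := by
        refine integral_mono (integrable_exp_neg_norm_sq_comp _ T) (integrable_const _)
          fun g => ?_
        exact Real.exp_le_one_iff.2 (by nlinarith [sq_nonneg ‖T g‖])
    _ = 1 := by simp

/-- Discard the decaying exponential of the standard Gaussian density and keep its normalization;
the substitution `y = T x` then leaves a total mass `1` times the Jacobian. -/
theorem integral_exp_neg_norm_sq_comp_le_inv_det
    {T : EuclideanSpace ℝ (Fin n) →ₗ[ℝ] EuclideanSpace ℝ (Fin n)} (hT : LinearMap.det T ≠ 0) :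
    ∫ g, Real.exp (-‖T g‖ ^ 2 / 2) ∂stdGaussian (EuclideanSpace ℝ (Fin n)) ≤
      |LinearMap.det T|⁻¹ := by
  have hTm : Measurable T := T.continuous_of_finiteDimensional.measurable
  have hone : ∫⁻ x : EuclideanSpace ℝ (Fin n),
      ENNReal.ofReal ((2 * Real.pi) ^ (-(n : ℝ) / 2) * Real.exp (-‖x‖ ^ 2 / 2)) = 1 := by
    rw [← setLIntegral_univ, ← withDensity_apply _ MeasurableSet.univ,
      ← stdGaussian_eq_withDensity, measure_univ]
  rw [integral_eq_lintegral_of_nonneg_ae (ae_of_all _ fun g => (Real.exp_pos _).le) (by fun_prop)]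
  refine ENNReal.toReal_le_of_le_ofReal (by positivity) ?_
  rw [stdGaussian_eq_withDensity, lintegral_withDensity_eq_lintegral_mul _ (by fun_prop)
    (by fun_prop)]
  calc _ ≤ ∫⁻ x : EuclideanSpace ℝ (Fin n),
        ENNReal.ofReal ((2 * Real.pi) ^ (-(n : ℝ) / 2) * Real.exp (-‖T x‖ ^ 2 / 2)) := by
        refine lintegral_mono fun x => ?_
        simp only [Pi.mul_apply]
        rw [← ENNReal.ofReal_mul (by positivity)]
        refine ENNReal.ofReal_le_ofReal ?_
        gcongr
        refine mul_le_of_le_one_right (by positivity) ?_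
        exact Real.exp_le_one_iff.2 (by nlinarith [sq_nonneg ‖x‖])
    _ = ∫⁻ x, ENNReal.ofReal ((2 * Real.pi) ^ (-(n : ℝ) / 2) * Real.exp (-‖x‖ ^ 2 / 2))
          ∂(Measure.map T volume) := by
        rw [lintegral_map (by fun_prop) hTm]
    _ = ENNReal.ofReal |LinearMap.det T|⁻¹ := by
        rw [Measure.map_linearMap_addHaar_eq_smul_addHaar _ hT, lintegral_smul_measure, hone,
          smul_eq_mul, mul_one, abs_inv]

variable {Ω : Type*} [MeasurableSpace Ω] {P : Measure Ω}

/-- The mean contributes only a phase, which the modulus removes. -/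
theorem norm_integral_exp_mul_I_of_hasGaussianLaw {Z : Ω → ℝ} (hZ : HasGaussianLaw Z P) :
    ‖∫ ω, Complex.exp (Z ω * Complex.I) ∂P‖ = Real.exp (-variance Z P / 2) := by
  have h1 : ∫ ω, Complex.exp (Z ω * Complex.I) ∂P = charFun (P.map Z) 1 := by
    rw [charFun_apply_real, integral_map hZ.aemeasurable (by fun_prop)]
    simp
  rw [h1, hZ.map_eq_gaussianReal, charFun_gaussianReal, Complex.norm_exp]
  congr 1
  simp [Real.coe_toNNReal _ (variance_nonneg _ _)]
  ring

variable [IsProbabilityMeasure P] {p : ℕ} {W : Fin p → Ω → EuclideanSpace ℝ (Fin n)}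

/-- Smoothed small ball estimate for a Gaussian vector `(W_1, …, W_p)`, by Fourier inversion. -/
theorem integral_prod_exp_neg_norm_sq_le (hWm : ∀ j, Measurable (W j))
    (hW : ∀ u : Fin p → EuclideanSpace ℝ (Fin n),
      HasGaussianLaw (fun ω => ∑ j, inner ℝ (u j) (W j ω)) P)
    (T : Fin p → EuclideanSpace ℝ (Fin n) →ₗ[ℝ] EuclideanSpace ℝ (Fin n))
    (hvar : ∀ u : Fin p → EuclideanSpace ℝ (Fin n),
      ∑ j, ‖T j (u j)‖ ^ 2 ≤ variance (fun ω => ∑ j, inner ℝ (u j) (W j ω)) P)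
    (v : Fin p → EuclideanSpace ℝ (Fin n)) :
    ∫ ω, ∏ j, Real.exp (-‖W j ω - v j‖ ^ 2 / 2) ∂P ≤
      ∏ j, ∫ g, Real.exp (-‖T j g‖ ^ 2 / 2) ∂stdGaussian (EuclideanSpace ℝ (Fin n)) := by
  set π : Measure (Fin p → EuclideanSpace ℝ (Fin n)) :=
    Measure.pi fun _ => stdGaussian (EuclideanSpace ℝ (Fin n)) with hπ
  set F : Ω → (Fin p → EuclideanSpace ℝ (Fin n)) → ℂ := fun ω g =>
    Complex.exp (((∑ j, inner ℝ (g j) (W j ω - v j) : ℝ) : ℂ) * Complex.I) with hF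
  have hFm : Measurable (Function.uncurry F) := by
    simp only [hF, Function.uncurry_def]
    refine Complex.measurable_exp.comp (Measurable.mul_const
      (Complex.measurable_ofReal.comp (Finset.measurable_sum _ fun j _ => ?_)) _)
    exact Measurable.inner (by fun_prop) (((hWm j).comp measurable_fst).sub_const _)
  have hFi : Integrable (Function.uncurry F) (P.prod π) := by
    refine Integrable.of_bound (C := 1) hFm.aestronglyMeasurable (ae_of_all _ fun q => ?_)
    simp only [hF, Function.uncurry_def]
    rw [Complex.norm_exp_ofReal_mul_I]
  -- Each Gaussian factor is the characteristic function of a standard Gaussian `g j` at `W j ω - v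
  -- j`.
  have h1 : ∀ ω, ((∏ j, Real.exp (-‖W j ω - v j‖ ^ 2 / 2) : ℝ) : ℂ) = ∫ g, F ω g ∂π := by
    intro ω
    have h2 : ∀ g, F ω g =
        ∏ j, Complex.exp (((inner ℝ (g j) (W j ω - v j) : ℝ) : ℂ) * Complex.I) := by
      intro g
      simp only [hF]
      rw [← Complex.exp_sum, Complex.ofReal_sum, Finset.sum_mul]
    simp_rw [h2]
    rw [hπ, integral_fintype_prod_eq_prod (f := fun j (x : EuclideanSpace ℝ (Fin n)) =>
      Complex.exp (((inner ℝ x (W j ω - v j) : ℝ) : ℂ) * Complex.I)), Complex.ofReal_prod]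
    refine Finset.prod_congr rfl fun j _ => ?_
    rw [← charFun_apply, charFun_stdGaussian]
    push_cast
    rfl
  -- After exchanging the integrals the shift `v` is a phase, so the bound is uniform in `v`.
  have h3 : ∀ g, ‖∫ ω, F ω g ∂P‖ ≤ ∏ j, Real.exp (-‖T j (g j)‖ ^ 2 / 2) := by
    intro g
    have h4 : ∀ ω, F ω g = Complex.exp (((∑ j, inner ℝ (g j) (W j ω) : ℝ) : ℂ) * Complex.I) *
        Complex.exp (((-∑ j, inner ℝ (g j) (v j) : ℝ) : ℂ) * Complex.I) := by
      intro ω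
      simp only [hF]
      rw [← Complex.exp_add, ← add_mul, ← Complex.ofReal_add]
      simp only [inner_sub_right, Finset.sum_sub_distrib]
      rw [sub_eq_add_neg]
    simp_rw [h4]
    rw [integral_mul_const, norm_mul, Complex.norm_exp_ofReal_mul_I, mul_one,
      norm_integral_exp_mul_I_of_hasGaussianLaw (hW g), ← Real.exp_sum]
    refine Real.exp_le_exp.2 ?_
    rw [← Finset.sum_div, Finset.sum_neg_distrib]
    linarith [hvar g]
  have h5 : ((∫ ω, ∏ j, Real.exp (-‖W j ω - v j‖ ^ 2 / 2) ∂P : ℝ) : ℂ) =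
      ∫ g, ∫ ω, F ω g ∂P ∂π := by
    rw [← integral_complex_ofReal, ← integral_integral_swap hFi]
    exact integral_congr_ae (ae_of_all _ h1)
  calc ∫ ω, ∏ j, Real.exp (-‖W j ω - v j‖ ^ 2 / 2) ∂P
      ≤ ‖((∫ ω, ∏ j, Real.exp (-‖W j ω - v j‖ ^ 2 / 2) ∂P : ℝ) : ℂ)‖ := by
        rw [Complex.norm_real]; exact le_abs_self _
    _ ≤ ∫ g, ‖∫ ω, F ω g ∂P‖ ∂π := by rw [h5]; exact norm_integral_le_integral_norm _
    _ ≤ ∫ g, ∏ j, Real.exp (-‖T j (g j)‖ ^ 2 / 2) ∂π := by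
        refine integral_mono_of_nonneg (ae_of_all _ fun _ => norm_nonneg _) ?_ (ae_of_all _ h3)
        exact Integrable.fintype_prod (f := fun j x => Real.exp (-‖T j x‖ ^ 2 / 2))
          fun j => integrable_exp_neg_norm_sq_comp _ (T j)
    _ = _ := by
        rw [hπ, integral_fintype_prod_eq_prod (f := fun j x => Real.exp (-‖T j x‖ ^ 2 / 2))]

/-- Small ball estimate for a Gaussian vector `(W_1, …, W_p)`: if `Var ∑ ⟨u_j, W_j⟩` dominates
`∑ |T_j u_j|²` with invertible `T_j`, then the probability that every `W_j` lies in a given ball of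
radius `r` is at most `∏ e^(1/2) (r^n / |det T_j|)^θ` for `θ ∈ [0, 1]`. -/
theorem measureReal_forall_norm_sub_le (hWm : ∀ j, Measurable (W j))
    (hW : ∀ u : Fin p → EuclideanSpace ℝ (Fin n),
      HasGaussianLaw (fun ω => ∑ j, inner ℝ (u j) (W j ω)) P)
    (T : Fin p → EuclideanSpace ℝ (Fin n) →ₗ[ℝ] EuclideanSpace ℝ (Fin n))
    (hT : ∀ j, LinearMap.det (T j) ≠ 0)
    (hvar : ∀ u : Fin p → EuclideanSpace ℝ (Fin n),
      ∑ j, ‖T j (u j)‖ ^ 2 ≤ variance (fun ω => ∑ j, inner ℝ (u j) (W j ω)) P)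
    (v : Fin p → EuclideanSpace ℝ (Fin n)) {r : ℝ} (hr : 0 < r) {θ : ℝ} (hθ : 0 ≤ θ)
    (hθ1 : θ ≤ 1) :
    P.real {ω | ∀ j, ‖W j ω - v j‖ ≤ r} ≤
      ∏ j, Real.exp (1 / 2) * (r ^ n / |LinearMap.det (T j)|) ^ θ := by
  have hsm : MeasurableSet {ω | ∀ j, ‖W j ω - v j‖ ≤ r} := by
    rw [ofPred_forall]
    exact MeasurableSet.iInter fun j => measurableSet_le ((hWm j).sub_const _).norm
      measurable_const
  -- Rescaling by `r⁻¹` turns the event into unit balls, on which each factor `exp (1 / 2) * exp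
  -- (-‖·‖² / 2)` is at least `1`.
  have key := integral_prod_exp_neg_norm_sq_le (P := P) (W := fun j ω => r⁻¹ • W j ω)
    (fun j => (hWm j).fun_const_smul _) (fun u => ?_) (fun j => r⁻¹ • T j) (fun u => ?_)
    (fun j => r⁻¹ • v j)
  rotate_left
  · simpa only [real_inner_smul_right, real_inner_smul_left] using hW fun j => r⁻¹ • u j
  · simpa only [real_inner_smul_right, real_inner_smul_left, LinearMap.smul_apply, map_smul] using
      hvar fun j => r⁻¹ • u j
  have hint : Integrable (fun ω => ∏ j, Real.exp (1 / 2) *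
      Real.exp (-‖r⁻¹ • W j ω - r⁻¹ • v j‖ ^ 2 / 2)) P := by
    refine Integrable.of_bound (C := ∏ _j : Fin p, Real.exp (1 / 2)) ?_ (ae_of_all _ fun ω => ?_)
    · refine Measurable.aestronglyMeasurable (Finset.measurable_prod _ fun j _ => ?_)
      have := hWm j
      fun_prop
    · rw [Real.norm_of_nonneg (by positivity)]
      refine Finset.prod_le_prod (fun j _ => by positivity) fun j _ => ?_
      refine mul_le_of_le_one_right (by positivity) (Real.exp_le_one_iff.2 ?_)
      nlinarith [sq_nonneg ‖r⁻¹ • W j ω - r⁻¹ • v j‖]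
  calc P.real {ω | ∀ j, ‖W j ω - v j‖ ≤ r}
      = ∫ ω, {ω | ∀ j, ‖W j ω - v j‖ ≤ r}.indicator (fun _ => (1 : ℝ)) ω ∂P := by
        rw [integral_indicator_const _ hsm, smul_eq_mul, mul_one]
    _ ≤ ∫ ω, ∏ j, Real.exp (1 / 2) * Real.exp (-‖r⁻¹ • W j ω - r⁻¹ • v j‖ ^ 2 / 2) ∂P := by
        refine integral_mono ((integrable_const _).indicator hsm) hint fun ω => ?_
        by_cases hω : ω ∈ {ω | ∀ j, ‖W j ω - v j‖ ≤ r}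
        swap
        · rw [indicator_of_notMem hω]
          positivity
        rw [indicator_of_mem hω]
        refine Finset.prod_const_one (ι := Fin p) (s := Finset.univ) |>.ge.trans ?_
        refine Finset.prod_le_prod (fun _ _ => zero_le_one) fun j _ => ?_
        rw [← Real.exp_add, ← smul_sub, norm_smul, norm_inv, Real.norm_of_nonneg hr.le]
        refine Real.one_le_exp ?_
        have h1 : r⁻¹ * ‖W j ω - v j‖ ≤ 1 := by
          rw [inv_mul_le_iff₀ hr, mul_one]; exact hω j
        have h2 : 0 ≤ r⁻¹ * ‖W j ω - v j‖ := by positivity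
        nlinarith
    _ = (∏ _j : Fin p, Real.exp (1 / 2)) *
        ∫ ω, ∏ j, Real.exp (-‖r⁻¹ • W j ω - r⁻¹ • v j‖ ^ 2 / 2) ∂P := by
        simp_rw [Finset.prod_mul_distrib]
        rw [integral_const_mul]
    _ ≤ (∏ _j : Fin p, Real.exp (1 / 2)) * ∏ j, ∫ g, Real.exp (-‖(r⁻¹ • T j) g‖ ^ 2 / 2)
          ∂stdGaussian (EuclideanSpace ℝ (Fin n)) := by
        gcongr
    _ ≤ _ := by
        rw [← Finset.prod_mul_distrib]
        refine Finset.prod_le_prod (fun j _ => mul_nonneg (Real.exp_pos _).le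
          (integral_nonneg fun _ => (Real.exp_pos _).le)) fun j _ => ?_
        gcongr
        have hdet : LinearMap.det (r⁻¹ • T j) = (r ^ n)⁻¹ * LinearMap.det (T j) := by
          rw [LinearMap.det_smul, finrank_euclideanSpace_fin, inv_pow]
        have hb := integral_exp_neg_norm_sq_comp_le_inv_det (T := r⁻¹ • T j)
          (by rw [hdet]; exact mul_ne_zero (by positivity) (hT j))
        have hb1 := integral_exp_neg_norm_sq_comp_le_one (r⁻¹ • T j)
        have hrw : |LinearMap.det (r⁻¹ • T j)|⁻¹ = r ^ n / |LinearMap.det (T j)| := by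
          rw [hdet, abs_mul, abs_of_pos (by positivity : (0 : ℝ) < (r ^ n)⁻¹), mul_inv, inv_inv,
            div_eq_mul_inv]
        rw [hrw] at hb
        have hpos : 0 < r ^ n / |LinearMap.det (T j)| := by
          have := abs_pos.2 (hT j)
          positivity
        -- With `q = r ^ n / |det T|` the two bounds give `min 1 q`, which is at most `q ^ θ` for `θ
        -- ∈ [0, 1]`.
        rcases le_total 1 (r ^ n / |LinearMap.det (T j)|) with h | h
        · exact hb1.trans (Real.one_le_rpow h hθ)
        · refine hb.trans ?_
          conv_lhs => rw [← Real.rpow_one (r ^ n / |LinearMap.det (T j)|)]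
          exact Real.rpow_le_rpow_of_exponent_ge hpos h hθ1

end GaussianEstimates

/-! ### Nearest-neighbour orderings and integrals along chains -/

section Chains

/-- Finitely many points can be ordered, with prescribed last point, in such a way that each point
has its predecessor as a nearest neighbour among the earlier points. -/
theorem exists_injective_nearest_chain {ι M : Type*} [DecidableEq ι] [PseudoMetricSpace M]
    (t : ι → M) (m : ℕ) (S : Finset ι) (hS : S.card = m + 1) (i : ι) (hi : i ∈ S) :
    ∃ f : Fin (m + 1) → ι, Function.Injective f ∧ (∀ j, f j ∈ S) ∧ f (Fin.last m) = i ∧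
      ∀ a b : Fin m, a ≤ b →
        dist (t (f b.succ)) (t (f b.castSucc)) ≤ dist (t (f b.succ)) (t (f a.castSucc)) := by
  induction m generalizing S i with
  | zero =>
    exact ⟨fun _ => i, fun a b _ => Fin.ext (by omega), fun _ => hi, rfl, fun a => a.elim0⟩
  | succ m ih =>
    have hcard : (S.erase i).card = m + 1 := by rw [Finset.card_erase_of_mem hi, hS]; rfl
    have hne : (S.erase i).Nonempty := Finset.card_pos.1 (by omega)
    -- The chain is built backwards: the predecessor of `i` is a nearest remaining point, and it
    -- becomes the prescribed last point of the shorter chain.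
    obtain ⟨i', hi', hmin⟩ := Finset.exists_min_image (S.erase i) (fun x => dist (t i) (t x)) hne
    obtain ⟨f, hf, hfS, hlast, hchain⟩ := ih (S.erase i) hcard i' hi'
    refine ⟨Fin.snoc f i, ?_, ?_, by simp, ?_⟩
    · rw [Fin.snoc_injective_iff]
      refine ⟨hf, ?_⟩
      rintro ⟨j, hj⟩
      exact Finset.ne_of_mem_erase (hfS j) hj
    · intro j
      refine Fin.lastCases ?_ (fun j => ?_) j
      · simpa using hi
      · simpa using Finset.mem_of_mem_erase (hfS j)
    · intro a b
      refine Fin.lastCases (fun _ => ?_) (fun b => ?_) b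
      · rw [Fin.succ_last, Fin.snoc_last, Fin.snoc_castSucc, Fin.snoc_castSucc, hlast]
        exact hmin _ (hfS a)
      · refine Fin.lastCases (fun h => ?_) (fun a h => ?_) a
        · exact absurd h (not_le.2 (Fin.castSucc_lt_last b))
        · rw [Fin.succ_castSucc, Fin.snoc_castSucc, Fin.snoc_castSucc, Fin.snoc_castSucc]
          exact hchain a b h

variable {M : Type*} [MeasureSpace M] [SigmaFinite (volume : Measure M)]

/-- Relabelling preserves null sets, so almost everywhere statements pass to reordered tuples, and
it gives all orderings the same integral. -/
theorem measurePreserving_comp_perm {ι : Type*} [Fintype ι] (π : Equiv.Perm ι) :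
    MeasurePreserving (fun t : ι → M => t ∘ π) := by
  have h := volume_measurePreserving_piCongrLeft (fun _ : ι => M) π.symm
  have he : ⇑(MeasurableEquiv.piCongrLeft (fun _ : ι => M) π.symm) = fun t : ι → M => t ∘ π := by
    funext t i
    rw [MeasurableEquiv.coe_piCongrLeft]
    have := Equiv.piCongrLeft_apply_apply (P := fun _ : ι => M) π.symm t (π i)
    rwa [Equiv.symm_apply_apply] at this
  rwa [he] at h

theorem lintegral_fin_succ {m : ℕ} {f : (Fin (m + 1) → M) → ℝ≥0∞} (hf : Measurable f) :
    ∫⁻ t, f t = ∫⁻ s : M, ∫⁻ t : Fin m → M, f (Fin.cons s t) := by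
  have h := (volume_preserving_piFinSuccAbove (fun _ : Fin (m + 1) => M) 0).symm
  rw [← h.lintegral_comp hf]
  have hm : Measurable fun q : M × (Fin m → M) =>
      f ((MeasurableEquiv.piFinSuccAbove (fun _ : Fin (m + 1) => M) 0).symm q) :=
    hf.comp (MeasurableEquiv.measurable _)
  rw [Measure.volume_eq_prod, lintegral_prod _ hm.aemeasurable]
  simp only [MeasurableEquiv.piFinSuccAbove_symm_apply, Fin.insertNthEquiv, Equiv.coe_fn_mk,
    Fin.insertNth_zero']

theorem measurable_fin_cons {M : Type*} [MeasurableSpace M] {m : ℕ} (s : M) :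
    Measurable fun t : Fin m → M => (Fin.cons s t : Fin (m + 1) → M) := by
  refine measurable_pi_iff.2 fun i => ?_
  refine Fin.cases ?_ (fun j => ?_) i
  · simp only [Fin.cons_zero]
    exact measurable_const
  · simp only [Fin.cons_succ]
    exact measurable_pi_apply _

theorem measurable_chain {M : Type*} [MeasurableSpace M] {H : M → M → ℝ≥0∞}
    (hH : Measurable (Function.uncurry H)) (m : ℕ) (s : M) :
    Measurable fun t : Fin m → M =>
      ∏ j : Fin m, H ((Fin.cons s t : Fin (m + 1) → M) j.castSucc) (t j) :=
  Finset.measurable_prod _ fun j _ =>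
    hH.comp (g := Function.uncurry H)
      (f := fun t : Fin m → M => ((Fin.cons s t : Fin (m + 1) → M) j.castSucc, t j))
      (((measurable_pi_apply j.castSucc).comp (measurable_fin_cons s)).prodMk
        (measurable_pi_apply j))

variable {H : M → M → ℝ≥0∞} {K : ℝ≥0∞}

/-- Peel off the first free point and apply induction from there. An almost everywhere bound on
starting points suffices, since the new starting point is itself integrated. -/
theorem lintegral_chain_le (hH : Measurable (Function.uncurry H))
    (hK : ∀ᵐ s : M, ∫⁻ t, H s t ≤ K) (m : ℕ) :
    ∀ᵐ s : M, ∫⁻ t : Fin m → M,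
      ∏ j : Fin m, H ((Fin.cons s t : Fin (m + 1) → M) j.castSucc) (t j) ≤ K ^ m := by
  induction m with
  | zero =>
    refine ae_of_all _ fun s => ?_
    simp [volume_pi]
  | succ m ih =>
    filter_upwards [hK] with s hs
    rw [lintegral_fin_succ (measurable_chain hH (m + 1) s)]
    have hpeel : ∀ (s' : M) (t : Fin m → M),
        ∏ j : Fin (m + 1), H ((Fin.cons s (Fin.cons s' t : Fin (m + 1) → M) :
          Fin (m + 2) → M) j.castSucc) ((Fin.cons s' t : Fin (m + 1) → M) j) =
        H s s' * ∏ j : Fin m, H ((Fin.cons s' t : Fin (m + 1) → M) j.castSucc) (t j) := by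
      intro s' t
      rw [Fin.prod_univ_succ]
      simp only [Fin.castSucc_zero, Fin.castSucc_succ, Fin.cons_zero, Fin.cons_succ]
    simp_rw [hpeel]
    calc ∫⁻ s', ∫⁻ t : Fin m → M,
          H s s' * ∏ j : Fin m, H ((Fin.cons s' t : Fin (m + 1) → M) j.castSucc) (t j)
        ≤ ∫⁻ s', H s s' * K ^ m := by
          refine lintegral_mono_ae ?_
          filter_upwards [ih] with s' hs'
          rw [lintegral_const_mul _ (measurable_chain hH m s')]
          gcongr
      _ = (∫⁻ s', H s s') * K ^ m :=
          lintegral_mul_const _ (hH.comp (measurable_const.prodMk measurable_id))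
      _ ≤ K ^ (m + 1) := by rw [pow_succ']; gcongr

/-- Integral of a product of kernels along a chain that starts in `A`. -/
theorem lintegral_indicator_mul_chain_le (hH : Measurable (Function.uncurry H))
    (hK : ∀ᵐ s : M, ∫⁻ t, H s t ≤ K) (m : ℕ) {A : Set M} (hA : MeasurableSet A) :
    ∫⁻ t : Fin (m + 1) → M, A.indicator 1 (t 0) * ∏ j : Fin m, H (t j.castSucc) (t j.succ) ≤
      volume A * K ^ m := by
  have hm : Measurable fun t : Fin (m + 1) → M =>
      ∏ j : Fin m, H (t j.castSucc) (t j.succ) :=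
    Finset.measurable_prod _ fun j _ =>
      hH.comp (g := Function.uncurry H) (f := fun t : Fin (m + 1) → M => (t j.castSucc, t j.succ))
        ((measurable_pi_apply _).prodMk (measurable_pi_apply _))
  have hA' : Measurable (A.indicator (1 : M → ℝ≥0∞)) := measurable_one.indicator hA
  have hF : Measurable fun t : Fin (m + 1) → M =>
      A.indicator 1 (t 0) * ∏ j : Fin m, H (t j.castSucc) (t j.succ) :=
    (hA'.comp (measurable_pi_apply 0)).mul hm
  rw [lintegral_fin_succ hF]
  simp only [Fin.cons_zero, Fin.cons_succ]
  calc _ ≤ ∫⁻ s : M, A.indicator 1 s * K ^ m := by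
        refine lintegral_mono_ae ?_
        filter_upwards [lintegral_chain_le hH hK m] with s hs
        rw [lintegral_const_mul _ (measurable_chain hH m s)]
        gcongr
    _ = _ := by
        rw [lintegral_mul_const _ hA', lintegral_indicator_one hA]

end Chains

/-! ### The parameter cube and pieces away from the origin -/

section UnitCube

variable {k : ℕ}

theorem isClosed_unitCube (k : ℕ) : IsClosed (unitCube k) := by
  have : unitCube k = ⋂ i, {t : EuclideanSpace ℝ (Fin k) | t i ∈ Icc (0 : ℝ) 1} := by
    ext t; simp [unitCube]
  rw [this]
  exact isClosed_iInter fun i => isClosed_Icc.preimage (by fun_prop)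

theorem norm_le_of_mem_unitCube {t : EuclideanSpace ℝ (Fin k)} (ht : t ∈ unitCube k) :
    ‖t‖ ≤ k + 1 := by
  have h1 : ‖t‖ ^ 2 ≤ k := by
    rw [EuclideanSpace.norm_sq_eq]
    calc ∑ i, ‖t i‖ ^ 2 ≤ ∑ _i : Fin k, (1 : ℝ) := by
          refine Finset.sum_le_sum fun i _ => ?_
          have := ht i
          rw [Real.norm_of_nonneg this.1]
          exact pow_le_one₀ this.1 this.2
      _ = k := by simp
  nlinarith [norm_nonneg t]

theorem volume_unitCube_apply {s : Set (unitCube k)} :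
    volume s = volume ((↑) '' s : Set (EuclideanSpace ℝ (Fin k))) :=
  comap_subtype_coe_apply (isClosed_unitCube k).measurableSet volume s

instance isFiniteMeasure_volume_unitCube : IsFiniteMeasure (volume : Measure (unitCube k)) := by
  refine ⟨?_⟩
  rw [volume_unitCube_apply]
  refine (measure_mono (t := Metric.closedBall 0 (k + 1)) ?_).trans_lt
    measure_closedBall_lt_top
  rintro _ ⟨t, -, rfl⟩
  simpa using norm_le_of_mem_unitCube t.2

/-- A set of parameters in a common axis-parallel cube of side `ε` whose points are no further from
each other than from the origin. -/
structure IsOffOrigin (ε : ℝ) (A : Set (unitCube k)) : Prop where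
  exists_corner : ∃ a : EuclideanSpace ℝ (Fin k), ∀ t ∈ A, ∀ m : Fin k,
    (t : EuclideanSpace ℝ (Fin k)) m ∈ Icc (a m) (a m + ε)
  dist_le : ∀ s ∈ A, ∀ t ∈ A, dist s t ≤ dist s (cubeOrigin k)

/-- A nearest-neighbour ordering settles the comparisons among the `t_i`; those with `t_0 = 0` hold
because points of `A` are no further from each other than from the origin. -/
theorem IsOffOrigin.exists_perm_admissible {ε : ℝ} {A : Set (unitCube k)} (hA : IsOffOrigin ε A)
    {m : ℕ} (t : Fin (m + 1) → unitCube k) (ht : ∀ i, t i ∈ A) :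
    ∃ π : Equiv.Perm (Fin (m + 1)), LNDAdmissible ε (t ∘ π) := by
  obtain ⟨f, hf, -, -, hchain⟩ :=
    exists_injective_nearest_chain t m Finset.univ (by simp) 0 (Finset.mem_univ _)
  refine ⟨Equiv.ofBijective f (Finite.injective_iff_bijective.1 hf), ?_, ?_⟩
  · obtain ⟨a, ha⟩ := hA.exists_corner
    exact ⟨a, fun j => ha _ (ht _)⟩
  · intro i j
    simp only [withOrigin, Fin.cons_succ, Function.comp_apply, Equiv.ofBijective_apply]
    refine Fin.cases (fun h => ?_) (fun b h => ?_) j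
    · rw [Fin.le_zero_iff.1 h]
    · rw [Fin.castSucc_succ, Fin.cons_succ]
      revert h
      refine Fin.cases (fun _ => ?_) (fun a h => ?_) i
      · simp only [Fin.castSucc_zero, Fin.cons_zero]
        exact hA.dist_le _ (ht _) _ (ht _)
      · rw [Fin.castSucc_succ, Fin.cons_succ]
        exact hchain a b (Fin.succ_le_succ_iff.1 h)

end UnitCube

/-! ### Small ball probabilities from local nondeterminism -/

section RandomFieldEstimates

variable {k n : ℕ} {Ω : Type*} [MeasurableSpace Ω] {P : Measure Ω}
  {X : unitCube k → Ω → EuclideanSpace ℝ (Fin n)}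

theorem measurable_det_incrementCov [IsProbabilityMeasure P]
    (hX : Measurable (Function.uncurry X)) :
    Measurable fun q : unitCube k × unitCube k => (incrementCov X P q.1 q.2).det := by
  have hinc : ∀ i : Fin n, Measurable fun p : (unitCube k × unitCube k) × Ω =>
      (X p.1.2 p.2 - X p.1.1 p.2) i := by
    intro i
    have h1 : Measurable fun p : (unitCube k × unitCube k) × Ω => X p.1.2 p.2 :=
      hX.comp (measurable_fst.snd.prodMk measurable_snd)
    have h2 : Measurable fun p : (unitCube k × unitCube k) × Ω => X p.1.1 p.2 :=
      hX.comp (measurable_fst.fst.prodMk measurable_snd)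
    exact (EuclideanSpace.proj (𝕜 := ℝ) i).continuous.measurable.comp (h1.sub h2)
  have hmean : ∀ i : Fin n, Measurable fun q : unitCube k × unitCube k =>
      ∫ ω, (X q.2 ω - X q.1 ω) i ∂P := fun i =>
    (hinc i).stronglyMeasurable.integral_prod_right'.measurable
  have hentry : ∀ i j : Fin n, Measurable fun q : unitCube k × unitCube k =>
      incrementCov X P q.1 q.2 i j := by
    intro i j
    simp only [incrementCov, Matrix.of_apply, covariance]
    refine StronglyMeasurable.measurable ?_
    refine StronglyMeasurable.integral_prod_right' (f := fun p : (unitCube k × unitCube k) × Ω =>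
      ((X p.1.2 p.2 - X p.1.1 p.2) i - ∫ ω, (X p.1.2 ω - X p.1.1 ω) i ∂P) *
      ((X p.1.2 p.2 - X p.1.1 p.2) j - ∫ ω, (X p.1.2 ω - X p.1.1 ω) j ∂P)) ?_
    exact (((hinc i).sub ((hmean i).comp measurable_fst)).mul
      ((hinc j).sub ((hmean j).comp measurable_fst))).stronglyMeasurable
  simp only [Matrix.det_apply]
  refine Finset.measurable_sum _ fun σ _ => Measurable.const_smul ?_ _
  exact Finset.measurable_prod _ fun i _ => hentry _ _

theorem hasGaussianLaw_sum_inner_increments (hX : IsGaussianProcess X P) {p : ℕ}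
    (t : Fin (p + 1) → unitCube k) (u : Fin p → EuclideanSpace ℝ (Fin n)) :
    HasGaussianLaw (fun ω => ∑ j, inner ℝ (u j) (X (t j.succ) ω - X (t j.castSucc) ω)) P := by
  have h := (hX.hasGaussianLaw_increments (t := t)).map_fun
    (∑ j, (innerSL ℝ (u j)).comp (ContinuousLinearMap.proj (R := ℝ) j))
  simpa using h

/-- In the variance bound of local nondeterminism all roots are invertible. -/
theorem det_ne_zero_of_le_variance (hn : 0 < n) {ℓ : ℕ} {c : ℝ} (hc : 0 < c)
    {σ : Fin ℓ → Matrix (Fin n) (Fin n) ℝ} {Z : Fin ℓ → Ω → EuclideanSpace ℝ (Fin n)}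
    (h : ∀ u : Fin ℓ → EuclideanSpace ℝ (Fin n), c * ∑ j, ‖u j‖ ^ 2 ≤
      variance (fun ω => ∑ j, inner ℝ (u j) (Matrix.toEuclideanLin (σ j)⁻¹ (Z j ω))) P)
    (i : Fin ℓ) : (σ i).det ≠ 0 := by
  intro hdet
  -- A singular matrix has inverse `0` by convention, so the variance vanishes on test vectors
  -- supported at `i`.
  have hinv : (σ i)⁻¹ = 0 := Matrix.nonsing_inv_apply_not_isUnit _ (by simp [hdet])
  set e : EuclideanSpace ℝ (Fin n) := EuclideanSpace.single ⟨0, hn⟩ 1 with he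
  have h1 := h (Pi.single i e)
  have h2 : (fun ω => ∑ j, inner ℝ ((Pi.single i e : Fin ℓ → EuclideanSpace ℝ (Fin n)) j)
      (Matrix.toEuclideanLin (σ j)⁻¹ (Z j ω))) = fun _ => (0 : ℝ) := by
    funext ω
    refine Finset.sum_eq_zero fun j _ => ?_
    rcases eq_or_ne j i with rfl | hj
    · rw [hinv]; simp
    · rw [Pi.single_eq_of_ne hj, inner_zero_left]
  have h3 : (1 : ℝ) ≤ ∑ j, ‖(Pi.single i e : Fin ℓ → EuclideanSpace ℝ (Fin n)) j‖ ^ 2 := by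
    refine le_trans ?_ (Finset.single_le_sum (f := fun j =>
      ‖(Pi.single i e : Fin ℓ → EuclideanSpace ℝ (Fin n)) j‖ ^ 2) (fun _ _ => by positivity)
      (Finset.mem_univ i))
    simp [he]
  rw [h2] at h1
  have h4 : variance (fun _ : Ω => (0 : ℝ)) P = 0 := variance_zero P
  rw [h4] at h1
  nlinarith

/-- The kernel that controls the small ball probabilities of increments. -/
noncomputable def incrementKernel (X : unitCube k → Ω → EuclideanSpace ℝ (Fin n)) (P : Measure Ω)
    (a : ℝ) (s t : unitCube k) : ℝ≥0∞ :=
  (ENNReal.ofReal |(incrementCov X P s t).det| ^ a)⁻¹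

theorem measurable_incrementKernel [IsProbabilityMeasure P]
    (hX : Measurable (Function.uncurry X)) (a : ℝ) :
    Measurable (Function.uncurry (incrementKernel X P a)) := by
  have h := measurable_det_incrementCov (P := P) hX
  have : Measurable fun q : unitCube k × unitCube k =>
      (ENNReal.ofReal |(incrementCov X P q.1 q.2).det| ^ a)⁻¹ :=
    ((measurable_abs.comp h).ennreal_ofReal.pow_const a).inv
  exact this

/-- Local nondeterminism bounds the probability that consecutive increments lie in given balls. -/
theorem LocallyNondeterministic.measure_increments_le [IsProbabilityMeasure P]
    (hX_meas : Measurable (Function.uncurry X)) (hX : IsGaussianProcess X P)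
    (hlnd : LocallyNondeterministic X P) (hn : 0 < n) {a : ℝ} (ha : 0 ≤ a) (ha1 : 2 * a ≤ 1)
    {p : ℕ} (hp : 1 ≤ p) :
    ∃ C : ℝ, ∃ ε > 0, ∀ᵐ t : Fin (p + 1) → unitCube k, LNDAdmissible ε t →
      ∀ (v : Fin p → EuclideanSpace ℝ (Fin n)) (r : ℝ), 0 < r →
        P {ω | ∀ j, ‖X (t j.succ) ω - X (t j.castSucc) ω - v j‖ ≤ r} ≤
          ∏ j : Fin p, ENNReal.ofReal (C * r ^ (2 * n * a)) *
            incrementKernel X P a (t j.castSucc) (t j.succ) := by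
  -- The `p + 1` points have `p + 1` increments when `t_0 = 0` is included; only the `p` increments
  -- between them are kept.
  obtain ⟨c, hc, ε, hε, hae⟩ := hlnd (p + 1) (by omega)
  refine ⟨Real.exp (1 / 2) * (√c ^ n)⁻¹ ^ (2 * a), ε, hε, ?_⟩
  filter_upwards [hae] with t ht hadm v r hr
  obtain ⟨σ, hσ, hvar⟩ := ht hadm
  have hdet := det_ne_zero_of_le_variance hn hc hvar
  have hcov : ∀ j : Fin p, incrementCov X P (t j.castSucc) (t j.succ) =
      σ j.succ * (σ j.succ).transpose := by
    intro j
    rw [hσ j.succ]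
    simp only [withOrigin, Fin.castSucc_succ, Fin.cons_succ]
  -- Since `|det T j| = √c ^ n * |det σ²| ^ (1 / 2)`, the small ball exponent `θ = 2 * a` produces
  -- `|det σ²| ^ (-a)`.
  set T : Fin p → EuclideanSpace ℝ (Fin n) →ₗ[ℝ] EuclideanSpace ℝ (Fin n) := fun j =>
    √c • Matrix.toEuclideanLin (σ j.succ).transpose with hT
  have hc' : 0 < √c := Real.sqrt_pos.2 hc
  have hTdet : ∀ j, LinearMap.det (T j) = √c ^ n * (σ j.succ).det := by
    intro j
    simp only [hT]
    rw [LinearMap.det_smul, finrank_euclideanSpace_fin,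
      show Matrix.toEuclideanLin (σ j.succ).transpose = Matrix.toLin (PiLp.basisFun 2 ℝ (Fin n))
        (PiLp.basisFun 2 ℝ (Fin n)) (σ j.succ).transpose by
          rw [← Matrix.toLpLin_eq_toLin],
      LinearMap.det_toLin, Matrix.det_transpose]
  have hTvar : ∀ u : Fin p → EuclideanSpace ℝ (Fin n), ∑ j, ‖T j (u j)‖ ^ 2 ≤
      variance (fun ω => ∑ j, inner ℝ (u j) (X (t j.succ) ω - X (t j.castSucc) ω)) P := by
    intro u
    -- The zero entry removes the increment from the origin; testing with `σᵀ u` cancels `σ⁻¹` and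
    -- leaves the increment itself.
    have h := hvar (Fin.cons 0 fun j => Matrix.toEuclideanLin (σ j.succ).transpose (u j))
    simp only [Fin.sum_univ_succ, Fin.cons_zero, Fin.cons_succ, norm_zero, inner_zero_left,
      withOrigin, Fin.castSucc_succ, zero_add, ne_eq, OfNat.ofNat_ne_zero, not_false_eq_true,
      zero_pow] at h
    have hin : ∀ (j : Fin p) (x : EuclideanSpace ℝ (Fin n)),
        inner ℝ (Matrix.toEuclideanLin (σ j.succ).transpose (u j))
          (Matrix.toEuclideanLin (σ j.succ)⁻¹ x) = inner ℝ (u j) x := by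
      intro j x
      have hadj : Matrix.toEuclideanLin (σ j.succ).transpose =
          LinearMap.adjoint (Matrix.toEuclideanLin (σ j.succ)) := by
        rw [← Matrix.toEuclideanLin_conjTranspose_eq_adjoint,
          Matrix.conjTranspose_eq_transpose_of_trivial]
      rw [hadj, LinearMap.adjoint_inner_left]
      congr 1
      have hu : IsUnit (σ j.succ).det := isUnit_iff_ne_zero.2 (hdet _)
      rw [show ∀ (M : Matrix (Fin n) (Fin n) ℝ) (y : EuclideanSpace ℝ (Fin n)),
        Matrix.toEuclideanLin M y = WithLp.toLp 2 (M.mulVec y.ofLp) from fun M y => rfl]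
      simp [Matrix.mulVec_mulVec, Matrix.mul_nonsing_inv _ hu]
    simp only [hin] at h
    refine le_trans (le_of_eq ?_) h
    rw [Finset.mul_sum]
    refine Finset.sum_congr rfl fun j _ => ?_
    simp only [hT, LinearMap.smul_apply, norm_smul, mul_pow]
    rw [Real.norm_of_nonneg hc'.le, Real.sq_sqrt hc.le]
  have hWm : ∀ j : Fin p, Measurable fun ω => X (t j.succ) ω - X (t j.castSucc) ω := fun j =>
    (hX_meas.comp measurable_prodMk_left).sub (hX_meas.comp measurable_prodMk_left)
  have key := measureReal_forall_norm_sub_le hWm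
    (hasGaussianLaw_sum_inner_increments hX t) T
    (fun j => by rw [hTdet]; exact mul_ne_zero (by positivity) (hdet _)) hTvar v hr
    (by positivity : 0 ≤ 2 * a) ha1
  rw [← ENNReal.ofReal_toReal (measure_ne_top P _)]
  refine (ENNReal.ofReal_le_ofReal key).trans (le_of_eq ?_)
  rw [ENNReal.ofReal_prod_of_nonneg fun j _ => by positivity]
  refine Finset.prod_congr rfl fun j _ => ?_
  have hd : 0 < |(σ j.succ).det| := abs_pos.2 (hdet _)
  have hD : |(incrementCov X P (t j.castSucc) (t j.succ)).det| = |(σ j.succ).det| ^ 2 := by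
    rw [hcov, Matrix.det_mul, Matrix.det_transpose, abs_mul, sq]
  unfold incrementKernel
  rw [hD, ENNReal.ofReal_rpow_of_pos (by positivity), ← ENNReal.ofReal_inv_of_pos (by positivity),
    ← ENNReal.ofReal_mul (by positivity)]
  congr 1
  have hq : r ^ n / |LinearMap.det (T j)| = r ^ n * ((√c ^ n)⁻¹ * |(σ j.succ).det|⁻¹) := by
    rw [hTdet, abs_mul, abs_of_pos (by positivity : 0 < √c ^ n), ← mul_inv, div_eq_mul_inv]
  rw [hq, Real.mul_rpow (by positivity) (by positivity), Real.mul_rpow (by positivity) (by positivity),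
    Real.inv_rpow hd.le, ← Real.rpow_natCast |(σ j.succ).det| 2, ← Real.rpow_mul hd.le,
    ← Real.rpow_natCast r n, ← Real.rpow_mul hr.le]
  push_cast
  rw [show (n : ℝ) * (2 * a) = 2 * n * a by ring]
  ring

end RandomFieldEstimates

/-! ### Moments of the occupation measure -/

section OccupationMoments

variable {k n : ℕ} {Ω : Type*} [MeasurableSpace Ω] {P : Measure Ω}
  {X : unitCube k → Ω → EuclideanSpace ℝ (Fin n)} {φ : unitCube k → EuclideanSpace ℝ (Fin n)}

/-- The tuples of parameters in `A` at which the values of `Y` have mutual distance at most `r`. -/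
def closeTuples (Y : unitCube k → EuclideanSpace ℝ (Fin n)) (A : Set (unitCube k)) (ℓ : ℕ)
    (r : ℝ) : Set (Fin ℓ → unitCube k) :=
  {t | (∀ i, t i ∈ A) ∧ ∀ i j, ‖Y (t i) - Y (t j)‖ ≤ r}

/-- The power is the volume of a product set, whose tuples have values in one ball and are therefore
mutually close. The right side does not depend on the centre `x`. -/
theorem volume_inter_preimage_closedBall_pow_le (Y : unitCube k → EuclideanSpace ℝ (Fin n))
    (A : Set (unitCube k)) (ℓ : ℕ) (x : EuclideanSpace ℝ (Fin n)) (r : ℝ) :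
    volume (A ∩ Y ⁻¹' Metric.closedBall x r) ^ ℓ ≤ volume (closeTuples Y A ℓ (2 * r)) := by
  have h := volume_pi_pi fun _ : Fin ℓ => A ∩ Y ⁻¹' Metric.closedBall x r
  rw [Finset.prod_const, Finset.card_univ, Fintype.card_fin] at h
  rw [← h]
  refine measure_mono fun t ht => ⟨fun i => (ht i (mem_univ i)).1, fun i j => ?_⟩
  have hi : dist (Y (t i)) x ≤ r := (ht i (mem_univ i)).2
  have hj : dist (Y (t j)) x ≤ r := (ht j (mem_univ j)).2
  rw [← dist_eq_norm]
  linarith [dist_triangle_right (Y (t i)) (Y (t j)) x]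

theorem measurableSet_closeTuples_prod (hX : Measurable (Function.uncurry X))
    (hφ : Measurable φ) {A : Set (unitCube k)} (hA : MeasurableSet A) (ℓ : ℕ) (r : ℝ) :
    MeasurableSet {q : Ω × (Fin ℓ → unitCube k) |
      q.2 ∈ closeTuples (fun t => X t q.1 + φ t) A ℓ r} := by
  have hY : ∀ i : Fin ℓ, Measurable fun q : Ω × (Fin ℓ → unitCube k) =>
      X (q.2 i) q.1 + φ (q.2 i) := by
    intro i
    have hi : Measurable fun q : Ω × (Fin ℓ → unitCube k) => q.2 i :=
      (measurable_pi_apply i).comp measurable_snd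
    have h1 : Measurable fun q : Ω × (Fin ℓ → unitCube k) => X (q.2 i) q.1 :=
      hX.comp (hi.prodMk measurable_fst)
    exact h1.add (hφ.comp hi)
  have he : {q : Ω × (Fin ℓ → unitCube k) |
      q.2 ∈ closeTuples (fun t => X t q.1 + φ t) A ℓ r} = (⋂ i, {q | q.2 i ∈ A}) ∩
      ⋂ i, ⋂ j, {q | ‖(X (q.2 i) q.1 + φ (q.2 i)) - (X (q.2 j) q.1 + φ (q.2 j))‖ ≤ r} := by
    ext q
    simp [closeTuples]
  rw [he]
  refine MeasurableSet.inter (MeasurableSet.iInter fun i => ?_)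
    (MeasurableSet.iInter fun i => MeasurableSet.iInter fun j => ?_)
  · exact ((measurable_pi_apply i).comp measurable_snd) hA
  · exact measurableSet_le ((hY i).sub (hY j)).norm measurable_const

/-- Moment estimate for the occupation measure of a piece of the parameter cube. -/
theorem lintegral_volume_closeTuples_le [IsProbabilityMeasure P]
    (hX : Measurable (Function.uncurry X)) (hφ : Measurable φ) {a C ε r : ℝ} {p : ℕ} (hr : 0 < r)
    (hinc : ∀ᵐ t : Fin (p + 1) → unitCube k, LNDAdmissible ε t →
      ∀ (v : Fin p → EuclideanSpace ℝ (Fin n)) (r : ℝ), 0 < r →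
        P {ω | ∀ j, ‖X (t j.succ) ω - X (t j.castSucc) ω - v j‖ ≤ r} ≤
          ∏ j : Fin p, ENNReal.ofReal (C * r ^ (2 * n * a)) *
            incrementKernel X P a (t j.castSucc) (t j.succ))
    {K : ℝ≥0∞} (hK : ∀ᵐ s : unitCube k, ∫⁻ t, incrementKernel X P a s t ≤ K)
    {A : Set (unitCube k)} (hA : MeasurableSet A) (hAε : IsOffOrigin ε A) :
    ∫⁻ ω, volume (closeTuples (fun t => X t ω + φ t) A (p + 1) r) ∂P ≤
      (p + 1).factorial * (volume A * (ENNReal.ofReal (C * r ^ (2 * n * a)) * K) ^ p) := by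
  set H : unitCube k → unitCube k → ℝ≥0∞ := fun s t =>
    ENNReal.ofReal (C * r ^ (2 * n * a)) * incrementKernel X P a s t with hHdef
  have hker := measurable_incrementKernel (P := P) hX a
  have hH : Measurable (Function.uncurry H) := hker.const_mul _
  have hHK : ∀ᵐ s : unitCube k, ∫⁻ t, H s t ≤ ENNReal.ofReal (C * r ^ (2 * n * a)) * K := by
    filter_upwards [hK] with s hs
    simp only [hHdef]
    rw [lintegral_const_mul _ hker.of_uncurry_left]
    gcongr
  set Q : (Fin (p + 1) → unitCube k) → ℝ≥0∞ := fun t =>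
    A.indicator 1 (t 0) * ∏ j : Fin p, H (t j.castSucc) (t j.succ) with hQ
  have hQm : Measurable Q := by
    refine Measurable.mul ((measurable_one.indicator hA).comp (measurable_pi_apply 0)) ?_
    exact Finset.measurable_prod _ fun j _ => hH.comp (g := Function.uncurry H)
      (f := fun t : Fin (p + 1) → unitCube k => (t j.castSucc, t j.succ))
      ((measurable_pi_apply _).prodMk (measurable_pi_apply _))
  have hmeas := measurableSet_closeTuples_prod hX hφ hA (p + 1) r
  have hswap : ∫⁻ ω, volume (closeTuples (fun t => X t ω + φ t) A (p + 1) r) ∂P =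
      ∫⁻ t, P {ω | t ∈ closeTuples (fun t => X t ω + φ t) A (p + 1) r} := by
    have h1 := Measure.prod_apply (μ := P)
      (ν := (volume : Measure (Fin (p + 1) → unitCube k))) hmeas
    rw [Measure.prod_apply_symm hmeas] at h1
    exact h1.symm
  -- The admissible ordering depends on `t`, so the exceptional null set must serve all permutations
  -- at once.
  have hperm : ∀ᵐ t : Fin (p + 1) → unitCube k, ∀ π : Equiv.Perm (Fin (p + 1)),
      LNDAdmissible ε (t ∘ π) →
      ∀ (v : Fin p → EuclideanSpace ℝ (Fin n)) (r : ℝ), 0 < r →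
        P {ω | ∀ j, ‖X ((t ∘ π) j.succ) ω - X ((t ∘ π) j.castSucc) ω - v j‖ ≤ r} ≤
          ∏ j : Fin p, ENNReal.ofReal (C * r ^ (2 * n * a)) *
            incrementKernel X P a ((t ∘ π) j.castSucc) ((t ∘ π) j.succ) := by
    rw [ae_all_iff]
    intro π
    exact (measurePreserving_comp_perm (M := unitCube k) π).quasiMeasurePreserving.ae hinc
  have hpt : ∀ᵐ t : Fin (p + 1) → unitCube k,
      P {ω | t ∈ closeTuples (fun t => X t ω + φ t) A (p + 1) r} ≤
        ∑ π : Equiv.Perm (Fin (p + 1)), Q (t ∘ π) := by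
    filter_upwards [hperm] with t ht
    by_cases htA : ∀ i, t i ∈ A
    swap
    · have : {ω | t ∈ closeTuples (fun t => X t ω + φ t) A (p + 1) r} = ∅ :=
        eq_empty_of_forall_notMem fun ω hω => htA hω.1
      rw [this, measure_empty]
      exact zero_le
    obtain ⟨π, hπ⟩ := hAε.exists_perm_admissible t htA
    refine le_trans ?_ (Finset.single_le_sum (f := fun π : Equiv.Perm (Fin (p + 1)) => Q (t ∘ π))
      (fun _ _ => zero_le) (Finset.mem_univ π))
    -- Closeness of the values of `X + φ` says that each increment of `X` is close to minus the
    -- increment of `φ`.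
    have h1 := ht π hπ (fun j => φ ((t ∘ π) j.castSucc) - φ ((t ∘ π) j.succ)) r hr
    simp only [hQ]
    rw [Function.comp_apply, indicator_of_mem (htA _), Pi.one_apply, one_mul]
    refine le_trans (measure_mono ?_) h1
    intro ω hω j
    simp only [Function.comp_apply]
    have h2 : ∀ x y z w : EuclideanSpace ℝ (Fin n), x - y - (w - z) = x + z - (y + w) := by
      intros; abel
    rw [h2]
    exact hω.2 (π j.succ) (π j.castSucc)
  calc ∫⁻ ω, volume (closeTuples (fun t => X t ω + φ t) A (p + 1) r) ∂P
      ≤ ∫⁻ t, ∑ π : Equiv.Perm (Fin (p + 1)), Q (t ∘ π) := by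
        rw [hswap]; exact lintegral_mono_ae hpt
    _ = ∑ π : Equiv.Perm (Fin (p + 1)), ∫⁻ t, Q (t ∘ π) :=
        lintegral_finsetSum _ fun π _ => hQm.comp (measurePreserving_comp_perm π).measurable
    _ = ∑ _π : Equiv.Perm (Fin (p + 1)), ∫⁻ t, Q t :=
        Finset.sum_congr rfl fun π _ => (measurePreserving_comp_perm π).lintegral_comp hQm
    _ = (p + 1).factorial * ∫⁻ t, Q t := by
        rw [Finset.sum_const, Finset.card_univ, Fintype.card_perm, Fintype.card_fin, nsmul_eq_mul]
    _ ≤ _ := by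
        gcongr
        exact lintegral_indicator_mul_chain_le hH hHK p hA

end OccupationMoments

/-! ### Covering the cube by pieces off the origin -/

section Cover

variable {k : ℕ}

/-- The parameter cube is covered by countably many sets off the origin, with finitely many of them
at each scale `4⁻ᵐ`. -/
theorem exists_cover_isOffOrigin (hk : 0 < k) {ε : ℝ} (hε : 0 < ε) :
    ∃ (F : Finset (EuclideanSpace ℝ (Fin k))) (A : ℕ × F → Set (unitCube k)) (V : ℝ≥0∞), V ≠ ∞ ∧
      (∀ i, MeasurableSet (A i)) ∧ (∀ i, IsOffOrigin ε (A i)) ∧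
      (∀ i, volume (A i) ≤ V * (4⁻¹ : ℝ≥0∞) ^ i.1) ∧ ∀ᵐ t, ∃ i, t ∈ A i := by
  set D : ℝ := k + 1 with hD
  have hD0 : 0 < D := by positivity
  -- On the shell `R / 4 ≤ ‖t‖ ≤ R`, the bound `1 / 8` makes the diameter `2 * R * ρ` at most the
  -- distance to the origin; the bound `ε / (2 * D)` fits each piece into a cube of side `ε`.
  set ρ : ℝ := min (1 / 8) (ε / (2 * D)) with hρ
  have hρ0 : 0 < ρ := lt_min (by norm_num) (by positivity)
  have hρ1 : ρ ≤ 1 / 8 := min_le_left _ _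
  have hρ2 : D * ρ ≤ ε / 2 := by
    have : ρ ≤ ε / (2 * D) := min_le_right _ _
    calc D * ρ ≤ D * (ε / (2 * D)) := by gcongr
      _ = ε / 2 := by field_simp
  obtain ⟨F, -, hF⟩ := (isCompact_closedBall (0 : EuclideanSpace ℝ (Fin k)) 1).elim_nhds_subcover
    (fun x => Metric.ball x ρ) (fun x _ => Metric.ball_mem_nhds x hρ0)
  set R : ℕ → ℝ := fun m => D * (1 / 4) ^ m with hR
  have hR0 : ∀ m, 0 < R m := fun m => by simp only [hR]; positivity
  have hRD : ∀ m, R m ≤ D := fun m =>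
    mul_le_of_le_one_right hD0.le (pow_le_one₀ (by norm_num) (by norm_num))
  set A : ℕ × F → Set (unitCube k) := fun i =>
    {t | R i.1 / 4 ≤ ‖(t : EuclideanSpace ℝ (Fin k))‖ ∧
      ‖(t : EuclideanSpace ℝ (Fin k))‖ ≤ R i.1 ∧
      ‖(t : EuclideanSpace ℝ (Fin k)) - R i.1 • (i.2 : EuclideanSpace ℝ (Fin k))‖ ≤ R i.1 * ρ}
    with hA
  refine ⟨F, A, ENNReal.ofReal (D ^ k) * volume (Metric.ball (0 : EuclideanSpace ℝ (Fin k)) 1),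
    ENNReal.mul_ne_top ENNReal.ofReal_ne_top measure_ball_lt_top.ne, fun i => ?_, fun i => ?_,
    fun i => ?_, ?_⟩
  · have h1 : Measurable fun t : unitCube k => ‖(t : EuclideanSpace ℝ (Fin k))‖ :=
      measurable_subtype_coe.norm
    have h2 : Measurable fun t : unitCube k => ‖(t : EuclideanSpace ℝ (Fin k)) -
        R i.1 • (i.2 : EuclideanSpace ℝ (Fin k))‖ := (measurable_subtype_coe.sub_const _).norm
    exact (measurableSet_le measurable_const h1).inter
      ((measurableSet_le h1 measurable_const).inter (measurableSet_le h2 measurable_const))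
  · constructor
    · refine ⟨WithLp.toLp 2 fun m =>
        R i.1 * (i.2 : EuclideanSpace ℝ (Fin k)) m - ε / 2, fun t ht m => ?_⟩
      have h1 := (PiLp.norm_apply_le ((t : EuclideanSpace ℝ (Fin k)) -
        R i.1 • (i.2 : EuclideanSpace ℝ (Fin k))) m).trans ht.2.2
      have h2 : R i.1 * ρ ≤ ε / 2 := (mul_le_mul_of_nonneg_right (hRD _) hρ0.le).trans hρ2
      have h3 := abs_le.1 (h1.trans h2)
      simp only [PiLp.sub_apply, PiLp.smul_apply, smul_eq_mul] at h3
      simp only [mem_Icc]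
      constructor <;> linarith [h3.1, h3.2]
    · intro s hs t ht
      have h1 : dist s t ≤ R i.1 * ρ + R i.1 * ρ := by
        rw [Subtype.dist_eq]
        refine (dist_triangle_right _ _ (R i.1 • (i.2 : EuclideanSpace ℝ (Fin k)))).trans ?_
        rw [dist_eq_norm, dist_eq_norm]
        exact add_le_add hs.2.2 ht.2.2
      have h2 : dist s (cubeOrigin k) = ‖(s : EuclideanSpace ℝ (Fin k))‖ := by
        rw [Subtype.dist_eq, cubeOrigin, dist_zero_right]
      rw [h2]
      refine h1.trans (le_trans ?_ hs.1)
      nlinarith [hR0 i.1]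
  · rw [volume_unitCube_apply]
    calc volume ((↑) '' A i : Set (EuclideanSpace ℝ (Fin k)))
        ≤ volume (Metric.closedBall (0 : EuclideanSpace ℝ (Fin k)) (R i.1)) := by
          refine measure_mono ?_
          rintro _ ⟨t, ht, rfl⟩
          simpa using ht.2.1
      _ = ENNReal.ofReal (R i.1 ^ k) * volume (Metric.ball (0 : EuclideanSpace ℝ (Fin k)) 1) := by
          rw [Measure.addHaar_closedBall _ _ (hR0 _).le, finrank_euclideanSpace_fin]
      _ ≤ ENNReal.ofReal (D ^ k * (1 / 4) ^ i.1) *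
            volume (Metric.ball (0 : EuclideanSpace ℝ (Fin k)) 1) := by
          gcongr
          simp only [hR]
          rw [mul_pow]
          gcongr
          exact pow_le_of_le_one (by positivity) (pow_le_one₀ (by norm_num) (by norm_num)) hk.ne'
      _ = _ := by
          have h4 : ENNReal.ofReal ((1 / 4) ^ i.1) = (4⁻¹ : ℝ≥0∞) ^ i.1 := by
            rw [ENNReal.ofReal_pow (by norm_num), one_div,
              ENNReal.ofReal_inv_of_pos (by norm_num), ENNReal.ofReal_ofNat]
          rw [ENNReal.ofReal_mul (pow_nonneg hD0.le k), h4]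
          ring
  · have : Nonempty (Fin k) := ⟨⟨0, hk⟩⟩
    have hnull : volume ({cubeOrigin k} : Set (unitCube k)) = 0 := by
      rw [volume_unitCube_apply, image_singleton, measure_singleton]
    filter_upwards [compl_mem_ae_iff.2 hnull] with t ht
    have ht0 : (t : EuclideanSpace ℝ (Fin k)) ≠ 0 := fun h => ht (Subtype.ext h)
    have hnorm : 0 < ‖(t : EuclideanSpace ℝ (Fin k))‖ := norm_pos_iff.2 ht0
    obtain ⟨m, hm1, hm2⟩ := exists_nat_pow_near_of_lt_one (div_pos hnorm hD0)
      ((div_le_one hD0).2 (norm_le_of_mem_unitCube t.2)) (by norm_num : (0 : ℝ) < 1 / 4)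
      (by norm_num)
    rw [lt_div_iff₀ hD0] at hm1
    rw [div_le_iff₀ hD0] at hm2
    have hle : ‖(t : EuclideanSpace ℝ (Fin k))‖ ≤ R m := by simp only [hR]; linarith
    have hge : R m / 4 ≤ ‖(t : EuclideanSpace ℝ (Fin k))‖ := by
      simp only [hR]; rw [pow_succ] at hm1; linarith
    have hmem : (R m)⁻¹ • (t : EuclideanSpace ℝ (Fin k)) ∈
        Metric.closedBall (0 : EuclideanSpace ℝ (Fin k)) 1 := by
      rw [mem_closedBall_zero_iff, norm_smul, norm_inv, Real.norm_of_nonneg (hR0 m).le,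
        inv_mul_le_iff₀ (hR0 m), mul_one]
      exact hle
    obtain ⟨x, hx, hxt⟩ := mem_iUnion₂.1 (hF hmem)
    refine ⟨(m, ⟨x, hx⟩), hge, hle, ?_⟩
    have h1 : (t : EuclideanSpace ℝ (Fin k)) - R m • x =
        R m • ((R m)⁻¹ • (t : EuclideanSpace ℝ (Fin k)) - x) := by
      rw [smul_sub, smul_inv_smul₀ (hR0 m).ne']
    simp only
    rw [h1, norm_smul, Real.norm_of_nonneg (hR0 m).le]
    gcongr
    rw [← dist_eq_norm]
    exact (Metric.mem_ball.1 hxt).le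

end Cover

/-! ### Almost sure ball growth of the occupation measure -/

section BallGrowth

variable {k n : ℕ} {Ω : Type*} [MeasurableSpace Ω] {P : Measure Ω}
  {X : unitCube k → Ω → EuclideanSpace ℝ (Fin n)} {φ : unitCube k → EuclideanSpace ℝ (Fin n)}

/-- Polynomial growth along dyadic radii implies polynomial growth. -/
theorem measure_closedBall_le_of_dyadic {E : Type*} [PseudoMetricSpace E] [MeasurableSpace E]
    (μ : Measure E) {C : ℝ≥0∞} {β : ℝ} (hβ : 0 ≤ β)
    (h : ∀ (x : E) (N : ℕ), μ (Metric.closedBall x ((1 / 2) ^ N)) ≤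
      C * ENNReal.ofReal (((1 / 2 : ℝ) ^ N) ^ β)) (x : E) {r : ℝ} (hr : 0 < r) :
    μ (Metric.closedBall x r) ≤ (C * ENNReal.ofReal (2 ^ β) + μ univ) * ENNReal.ofReal (r ^ β) := by
  rcases le_or_gt r 1 with h1 | h1
  · obtain ⟨N, hN1, hN2⟩ := exists_nat_pow_near_of_lt_one hr h1 (by norm_num : (0 : ℝ) < 1 / 2)
      (by norm_num)
    calc μ (Metric.closedBall x r) ≤ μ (Metric.closedBall x ((1 / 2) ^ N)) := by gcongr
      _ ≤ C * ENNReal.ofReal (((1 / 2 : ℝ) ^ N) ^ β) := h x N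
      _ ≤ C * ENNReal.ofReal ((2 * r) ^ β) := by
          gcongr
          rw [pow_succ] at hN1
          linarith
      _ = C * ENNReal.ofReal (2 ^ β) * ENNReal.ofReal (r ^ β) := by
          rw [Real.mul_rpow (by norm_num) hr.le, ENNReal.ofReal_mul (by positivity), mul_assoc]
      _ ≤ _ := by gcongr; exact le_self_add
  · calc μ (Metric.closedBall x r) ≤ μ univ * 1 := by rw [mul_one]; exact measure_mono (subset_univ _)
      _ ≤ (C * ENNReal.ofReal (2 ^ β) + μ univ) * ENNReal.ofReal (r ^ β) := by
          gcongr
          · exact le_add_self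
          · rw [ENNReal.one_le_ofReal]
            exact Real.one_le_rpow h1.le hβ

/-- If the tuples of close parameters satisfy summable moment bounds, the occupation measures have
polynomial ball growth almost surely. -/
theorem ae_exists_occupationMeasure_closedBall_le [IsProbabilityMeasure P]
    (hX : Measurable (Function.uncurry X)) (hφ : Measurable φ) {ι : Type*} [Fintype ι]
    {A : ℕ × ι → Set (unitCube k)} {V : ℝ≥0∞} (hV : V ≠ ∞) (hAm : ∀ i, MeasurableSet (A i))
    (hAV : ∀ i, volume (A i) ≤ V * (4⁻¹ : ℝ≥0∞) ^ i.1) (hcover : ∀ᵐ t, ∃ i, t ∈ A i)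
    {p : ℕ} {b β : ℝ} (hβ : 0 ≤ β) (hb : (p + 1) * β < p * b) {L : ℝ≥0∞} (hL : L ≠ ∞)
    (hmom : ∀ i, ∀ r : ℝ, 0 < r →
      ∫⁻ ω, volume (closeTuples (fun t => X t ω + φ t) (A i) (p + 1) r) ∂P ≤
        L * volume (A i) * ENNReal.ofReal (r ^ (p * b))) :
    ∀ᵐ ω ∂P, ∃ C : ℝ≥0∞, C ≠ ∞ ∧ ∀ x, ∀ r : ℝ, 0 < r →
      occupationMeasure (fun t => X t ω + φ t) (Metric.closedBall x r) ≤
        C * ENNReal.ofReal (r ^ β) := by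
  set ρ : ℕ → ℝ := fun N => (1 / 2) ^ N with hρ
  have hρ0 : ∀ N, 0 < ρ N := fun N => by simp only [hρ]; positivity
  set S : ℕ → ℕ × ι → Ω → ℝ≥0∞ := fun N i ω =>
    volume (closeTuples (fun t => X t ω + φ t) (A i) (p + 1) (2 * ρ N)) with hS
  have hSm : ∀ N i, Measurable (S N i) := fun N i =>
    measurable_measure_prodMk_left (measurableSet_closeTuples_prod hX hφ (hAm i) (p + 1) (2 * ρ N))
  -- One integrable random variable controls every scale `N` and piece `i`. The weight `2 ^ i.1`
  -- uses half of the decay `4 ^ (-i.1)` of the volumes; the rest keeps the expectation summable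
  -- over pieces, and the weight itself provides the decay needed after taking roots.
  set Z : Ω → ℝ≥0∞ := fun ω => ∑' N : ℕ, ∑' i : ℕ × ι,
    ENNReal.ofReal (ρ N ^ (-((p + 1) * β))) * 2 ^ i.1 * S N i ω with hZ
  have hZm : ∀ N i, Measurable fun ω =>
      ENNReal.ofReal (ρ N ^ (-((p + 1) * β))) * 2 ^ i.1 * S N i ω := fun N i =>
    (hSm N i).const_mul _
  have hZint : ∫⁻ ω, Z ω ∂P ≠ ∞ := by
    simp only [hZ]
    rw [lintegral_tsum fun N => (Measurable.tsum (hZm N)).aemeasurable]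
    -- The surplus `q > 0` is the ratio exponent of a geometric series in `N`.
    set q : ℝ := p * b - (p + 1) * β with hq
    have hq0 : 0 < q := by linarith
    have hterm : ∀ N, ∫⁻ ω, ∑' i : ℕ × ι,
        ENNReal.ofReal (ρ N ^ (-((p + 1) * β))) * 2 ^ i.1 * S N i ω ∂P ≤
        L * V * ENNReal.ofReal (2 ^ (p * b)) * (Fintype.card ι * 2) *
          ENNReal.ofReal ((1 / 2) ^ q) ^ N := by
      intro N
      rw [lintegral_tsum fun i => (hZm N i).aemeasurable]
      have hρq : ρ N ^ (-((p + 1) * β)) * (2 * ρ N) ^ (p * b) =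
          2 ^ (p * b) * ((1 / 2) ^ q) ^ N := by
        rw [Real.mul_rpow (by norm_num) (hρ0 N).le, mul_left_comm, ← Real.rpow_add (hρ0 N)]
        congr 1
        rw [show -((p + 1) * β) + p * b = q by rw [hq]; ring]
        simp only [hρ]
        rw [← Real.rpow_natCast, ← Real.rpow_natCast, ← Real.rpow_mul (by norm_num),
          ← Real.rpow_mul (by norm_num), mul_comm]
      calc ∑' i : ℕ × ι, ∫⁻ ω, ENNReal.ofReal (ρ N ^ (-((p + 1) * β))) * 2 ^ i.1 * S N i ω ∂P
          ≤ ∑' i : ℕ × ι, L * V * ENNReal.ofReal (2 ^ (p * b)) *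
              ENNReal.ofReal ((1 / 2) ^ q) ^ N * (2⁻¹ : ℝ≥0∞) ^ i.1 := by
            refine ENNReal.tsum_le_tsum fun i => ?_
            rw [lintegral_const_mul _ (hSm N i)]
            have h24 : (2 : ℝ≥0∞) ^ i.1 * (4⁻¹ : ℝ≥0∞) ^ i.1 = (2⁻¹ : ℝ≥0∞) ^ i.1 := by
              rw [← mul_pow]
              congr 1
              rw [show (4 : ℝ≥0∞) = 2 * 2 by norm_num,
                ENNReal.mul_inv (by simp) (by simp), ← mul_assoc,
                ENNReal.mul_inv_cancel (by simp) (by simp), one_mul]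
            calc ENNReal.ofReal (ρ N ^ (-((p + 1) * β))) * 2 ^ i.1 * ∫⁻ ω, S N i ω ∂P
                ≤ ENNReal.ofReal (ρ N ^ (-((p + 1) * β))) * 2 ^ i.1 *
                  (L * (V * (4⁻¹ : ℝ≥0∞) ^ i.1) * ENNReal.ofReal ((2 * ρ N) ^ (p * b))) := by
                  refine mul_le_mul_right ((hmom i _ (by linarith [hρ0 N])).trans ?_) _
                  gcongr
                  exact hAV i
              _ = L * V * (ENNReal.ofReal (ρ N ^ (-((p + 1) * β))) *
                  ENNReal.ofReal ((2 * ρ N) ^ (p * b))) * (2 ^ i.1 * (4⁻¹ : ℝ≥0∞) ^ i.1) := by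
                  ring
              _ = _ := by
                  rw [h24, ← ENNReal.ofReal_mul (Real.rpow_nonneg (hρ0 N).le _), hρq,
                    ENNReal.ofReal_mul (by positivity), ENNReal.ofReal_pow (by positivity)]
                  ring
        _ = _ := by
            rw [ENNReal.tsum_mul_left, ENNReal.tsum_prod (f := fun m (_ : ι) => (2⁻¹ : ℝ≥0∞) ^ m)]
            simp only [tsum_fintype, Finset.sum_const, Finset.card_univ, nsmul_eq_mul]
            rw [ENNReal.tsum_mul_left, ENNReal.tsum_geometric, ENNReal.one_sub_inv_two, inv_inv]
            ring
    refine ((ENNReal.tsum_le_tsum hterm).trans_lt ?_).ne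
    rw [ENNReal.tsum_mul_left, ENNReal.tsum_geometric]
    refine ENNReal.mul_lt_top (ENNReal.mul_lt_top (ENNReal.mul_lt_top
      (ENNReal.mul_lt_top hL.lt_top hV.lt_top) ENNReal.ofReal_lt_top)
      (ENNReal.mul_lt_top (by simp) (by simp))) (ENNReal.inv_lt_top.2 ?_)
    rw [tsub_pos_iff_lt, ENNReal.ofReal_lt_one]
    exact Real.rpow_lt_one (by norm_num) (by norm_num) hq0
  have hZmeas : Measurable Z := Measurable.tsum fun N => Measurable.tsum (hZm N)
  filter_upwards [ae_lt_top hZmeas hZint] with ω hω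
  have hYm : Measurable fun t => X t ω + φ t := (hX.comp measurable_prodMk_right).add hφ
  -- Taking `(p + 1)`-st roots recovers the volumes from their powers and still leaves a geometric
  -- series over the pieces.
  set e : ℝ := ((p + 1 : ℕ) : ℝ)⁻¹ with he
  have he0 : 0 < e := by positivity
  set G : ℝ≥0∞ := ∑' i : ℕ × ι, ((2⁻¹ : ℝ≥0∞) ^ e) ^ i.1 with hG
  have hGt : G ≠ ∞ := by
    rw [hG, ENNReal.tsum_prod (f := fun m (_ : ι) => ((2⁻¹ : ℝ≥0∞) ^ e) ^ m)]
    simp only [tsum_fintype, Finset.sum_const, Finset.card_univ, nsmul_eq_mul]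
    rw [ENNReal.tsum_mul_left, ENNReal.tsum_geometric]
    refine ENNReal.mul_ne_top (by simp) (ENNReal.inv_ne_top.2 (tsub_pos_iff_lt.2 ?_).ne')
    exact ENNReal.rpow_lt_one (by norm_num) he0
  have hpiece : ∀ x N i, volume (A i ∩ (fun t => X t ω + φ t) ⁻¹' Metric.closedBall x (ρ N)) ≤
      Z ω ^ e * ENNReal.ofReal (ρ N ^ β) * ((2⁻¹ : ℝ≥0∞) ^ e) ^ i.1 := by
    intro x N i
    have h1 : ENNReal.ofReal (ρ N ^ (-((p + 1) * β))) * 2 ^ i.1 * S N i ω ≤ Z ω :=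
      (ENNReal.le_tsum i).trans (ENNReal.le_tsum (f := fun N => ∑' i : ℕ × ι,
        ENNReal.ofReal (ρ N ^ (-((p + 1) * β))) * 2 ^ i.1 * S N i ω) N)
    have h2 := volume_inter_preimage_closedBall_pow_le (fun t => X t ω + φ t) (A i) (p + 1) x (ρ N)
    have h3 : S N i ω ≤ Z ω * ENNReal.ofReal (ρ N ^ ((p + 1) * β)) * (2⁻¹ : ℝ≥0∞) ^ i.1 := by
      have h4 : ENNReal.ofReal (ρ N ^ ((p + 1) * β)) * ENNReal.ofReal (ρ N ^ (-((p + 1) * β))) =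
          1 := by
        rw [← ENNReal.ofReal_mul (Real.rpow_nonneg (hρ0 N).le _), ← Real.rpow_add (hρ0 N)]
        simp
      have h5 : (2⁻¹ : ℝ≥0∞) ^ i.1 * 2 ^ i.1 = 1 := by
        rw [← mul_pow, ENNReal.inv_mul_cancel (by simp) (by simp), one_pow]
      calc S N i ω = (ENNReal.ofReal (ρ N ^ (-((p + 1) * β))) * 2 ^ i.1 * S N i ω) *
            ENNReal.ofReal (ρ N ^ ((p + 1) * β)) * (2⁻¹ : ℝ≥0∞) ^ i.1 := by
            calc S N i ω = (ENNReal.ofReal (ρ N ^ ((p + 1) * β)) *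
                  ENNReal.ofReal (ρ N ^ (-((p + 1) * β)))) * ((2⁻¹ : ℝ≥0∞) ^ i.1 * 2 ^ i.1) *
                  S N i ω := by rw [h4, h5, one_mul, one_mul]
              _ = _ := by ring
        _ ≤ _ := by gcongr
    have h6 := ENNReal.rpow_le_rpow (h2.trans h3) he0.le
    rw [← ENNReal.rpow_natCast, ← ENNReal.rpow_mul, he,
      mul_inv_cancel₀ (by positivity), ENNReal.rpow_one, ← he,
      ENNReal.mul_rpow_of_nonneg _ _ he0.le, ENNReal.mul_rpow_of_nonneg _ _ he0.le,
      ENNReal.ofReal_rpow_of_nonneg (Real.rpow_nonneg (hρ0 N).le _) he0.le,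
      ← Real.rpow_mul (hρ0 N).le] at h6
    have h7 : (p + 1) * β * e = β := by
      rw [he]
      push_cast
      field_simp
    rw [h7, ← ENNReal.rpow_natCast, ← ENNReal.rpow_mul, mul_comm ((i.1 : ℕ) : ℝ) e,
      ENNReal.rpow_mul, ENNReal.rpow_natCast] at h6
    exact h6
  have hdyadic : ∀ x N, occupationMeasure (fun t => X t ω + φ t) (Metric.closedBall x (ρ N)) ≤
      (Z ω ^ e * G) * ENNReal.ofReal (ρ N ^ β) := by
    intro x N
    unfold occupationMeasure
    rw [Measure.map_apply hYm Metric.isClosed_closedBall.measurableSet]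
    calc volume ((fun t => X t ω + φ t) ⁻¹' Metric.closedBall x (ρ N))
        ≤ volume (⋃ i, A i ∩ (fun t => X t ω + φ t) ⁻¹' Metric.closedBall x (ρ N)) := by
          refine measure_mono_ae ?_
          filter_upwards [hcover] with t ht htB
          obtain ⟨i, hi⟩ := ht
          exact mem_iUnion.2 ⟨i, hi, htB⟩
      _ ≤ ∑' i, volume (A i ∩ (fun t => X t ω + φ t) ⁻¹' Metric.closedBall x (ρ N)) :=
          measure_iUnion_le _
      _ ≤ ∑' i : ℕ × ι, Z ω ^ e * ENNReal.ofReal (ρ N ^ β) * ((2⁻¹ : ℝ≥0∞) ^ e) ^ i.1 :=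
          ENNReal.tsum_le_tsum (hpiece x N)
      _ = _ := by rw [ENNReal.tsum_mul_left]; ring
  refine ⟨Z ω ^ e * G * ENNReal.ofReal (2 ^ β) +
    occupationMeasure (fun t => X t ω + φ t) univ, ?_, fun x r hr =>
      measure_closedBall_le_of_dyadic _ hβ hdyadic x hr⟩
  refine ENNReal.add_ne_top.2 ⟨ENNReal.mul_ne_top (ENNReal.mul_ne_top
    (ENNReal.rpow_ne_top_of_nonneg he0.le hω.ne) hGt) ENNReal.ofReal_ne_top, ?_⟩
  unfold occupationMeasure
  rw [Measure.map_apply hYm MeasurableSet.univ]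
  exact measure_ne_top _ _

/-- Determinants at least `1` are covered by the summand `1`, smaller ones by the larger exponent.
This permits shrinking `δ` in the integrability hypothesis. -/
theorem incrementKernel_le_one_add {a a' : ℝ} (ha : 0 < a) (haa' : a ≤ a') (s t : unitCube k) :
    incrementKernel X P a s t ≤ 1 + incrementKernel X P a' s t := by
  unfold incrementKernel
  rcases le_total 1 (ENNReal.ofReal |(incrementCov X P s t).det|) with h | h
  · exact (ENNReal.inv_le_one.2 (ENNReal.one_le_rpow h ha)).trans le_self_add
  · exact (ENNReal.inv_le_inv.2 (ENNReal.rpow_le_rpow_of_exponent_ge h haa')).trans le_add_self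

/-- Nondegeneracy of the increments excludes a parameter cube that is a single point. -/
theorem pos_of_ae_det_pos (hn : 0 < n)
    (hdet : ∀ᵐ p : unitCube k × unitCube k, 0 < (incrementCov X P p.1 p.2).det) : 0 < k := by
  by_contra hk
  obtain rfl : k = 0 := by omega
  have hvol : volume (univ : Set (unitCube 0)) ≠ 0 := by
    intro h1
    have h2 : ((↑) '' (univ : Set (unitCube 0)) : Set (EuclideanSpace ℝ (Fin 0))) = univ :=
      eq_univ_of_forall fun x => ⟨cubeOrigin 0, mem_univ _, Subsingleton.elim _ _⟩
    rw [volume_unitCube_apply, h2] at h1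
    exact (isOpen_univ.measure_pos volume univ_nonempty).ne' h1
  have hprod : (volume : Measure (unitCube 0 × unitCube 0)) ≠ 0 := by
    intro h
    have h1 := Measure.prod_prod (μ := (volume : Measure (unitCube 0)))
      (ν := (volume : Measure (unitCube 0))) univ univ
    rw [← Measure.volume_eq_prod, h, Measure.coe_zero, Pi.zero_apply] at h1
    exact mul_ne_zero hvol hvol h1.symm
  have : (ae (volume : Measure (unitCube 0 × unitCube 0))).NeBot := ae_neBot.2 hprod
  obtain ⟨q, hq⟩ := hdet.exists
  have hq' : q.1 = q.2 := Subsingleton.elim _ _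
  have hzero : incrementCov X P q.1 q.2 = 0 := by
    ext i j
    simp only [incrementCov, hq', sub_self, Matrix.of_apply, Matrix.zero_apply]
    exact covariance_zero_left
  have : Nonempty (Fin n) := ⟨⟨0, hn⟩⟩
  rw [hzero, Matrix.det_zero] at hq
  exact hq.false

end BallGrowth

/-! ### Choice of exponents and conclusion -/

theorem theoremT {k n : ℕ} {Ω : Type*} [MeasurableSpace Ω] (P : Measure Ω)
    [IsProbabilityMeasure P]
    (X : unitCube k → Ω → EuclideanSpace ℝ (Fin n))
    (hX_meas : Measurable (Function.uncurry X))
    (hX_gauss : IsGaussianProcess X P)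
    (hX_centered : ∀ t, ∫ ω, X t ω ∂P = 0)
    (hX_zero : ∀ᵐ ω ∂P, X (cubeOrigin k) ω = 0)
    (φ : unitCube k → EuclideanSpace ℝ (Fin n))
    (hφ_meas : Measurable φ) (hφ_bdd : ∃ C : ℝ, ∀ t, ‖φ t‖ ≤ C)
    (hdet : ∀ᵐ p : unitCube k × unitCube k, 0 < (incrementCov X P p.1 p.2).det)
    (hlnd : LocallyNondeterministic X P)
    (α : ℝ) (hα_pos : 0 < α) (hα_lt : α < n)
    (hcov : ∃ δ : ℝ, 0 < δ ∧
      essSup (fun s : unitCube k => ∫⁻ t : unitCube k,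
        (ENNReal.ofReal |(incrementCov X P s t).det| ^ ((n - α) / (2 * n) + δ))⁻¹) volume < ∞) :
    ∃ γ : ℝ≥0, 0 < γ ∧ γ ≤ 1 ∧ ∀ᵐ ω ∂P,
      (∀ x, besselPotential α (occupationMeasure fun t => X t ω + φ t) x < ∞) ∧
      LocallyHolder γ
        (fun x => (besselPotential α (occupationMeasure fun t => X t ω + φ t) x).toReal) := by
  obtain ⟨δ, hδ, hess⟩ := hcov
  have hnR : (0 : ℝ) < n := hα_pos.trans hα_lt
  have hn : 0 < n := by exact_mod_cast hnR
  have hk : 0 < k := pos_of_ae_det_pos hn hdet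

  -- The cut at `α / (2 * n)` ensures `2 * a ≤ 1`, as the small ball estimate requires.
  set δ' : ℝ := min δ (α / (2 * n)) with hδ'
  have hδ'0 : 0 < δ' := lt_min hδ (by positivity)
  set a : ℝ := (n - α) / (2 * n) + δ' with ha
  have ha0 : 0 < a := add_pos (div_pos (by linarith) (by positivity)) hδ'0
  have ha1 : 2 * a ≤ 1 := by
    have h1 : δ' ≤ α / (2 * n) := min_le_right _ _
    have h2 : (n - α) / (2 * n) + α / (2 * n) = 1 / 2 := by field_simp; ring
    linarith
  set b : ℝ := 2 * n * a with hb
  have hbeq : b = n - α + 2 * n * δ' := by rw [hb, ha]; field_simp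
  -- The midpoint between `n - α`, which the potential estimate must exceed, and `b`, which the
  -- moments provide.
  set β : ℝ := n - α + n * δ' with hβ
  have hnδ : 0 < n * δ' := mul_pos hnR hδ'0
  have hβ0 : 0 < β := by rw [hβ]; linarith
  have hβb : β < b := by rw [hbeq, hβ]; linarith
  -- For `b > β` this choice is equivalent to `(p + 1) * β < p * b`.
  obtain ⟨p, hp⟩ := exists_nat_gt (β / (b - β))
  have hp1 : 1 ≤ p := by
    have : (0 : ℝ) < p := (div_pos hβ0 (sub_pos.2 hβb)).trans hp
    exact_mod_cast this
  have hpb : (p + 1) * β < p * b := by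
    rw [div_lt_iff₀ (sub_pos.2 hβb)] at hp
    linarith
  -- integrability of the kernel of the increments
  set K₀ : ℝ≥0∞ := essSup (fun s : unitCube k => ∫⁻ t : unitCube k,
    (ENNReal.ofReal |(incrementCov X P s t).det| ^ ((n - α) / (2 * n) + δ))⁻¹) volume with hK₀
  have hK : ∀ᵐ s : unitCube k, ∫⁻ t, incrementKernel X P a s t ≤
      volume (univ : Set (unitCube k)) + K₀ := by
    filter_upwards [ENNReal.ae_le_essSup (μ := volume) fun s : unitCube k => ∫⁻ t : unitCube k,
      (ENNReal.ofReal |(incrementCov X P s t).det| ^ ((n - α) / (2 * n) + δ))⁻¹] with s hs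
    calc ∫⁻ t, incrementKernel X P a s t
        ≤ ∫⁻ t, (1 + incrementKernel X P ((n - α) / (2 * n) + δ) s t) :=
          lintegral_mono fun t => incrementKernel_le_one_add ha0
            (by rw [ha]; linarith [min_le_left δ (α / (2 * n))]) s t
      _ = volume (univ : Set (unitCube k)) +
            ∫⁻ t, incrementKernel X P ((n - α) / (2 * n) + δ) s t := by
          rw [lintegral_add_left measurable_const, lintegral_one]
      _ ≤ _ := by gcongr; exact hs
  obtain ⟨C, ε, hε, hinc⟩ := hlnd.measure_increments_le hX_meas hX_gauss hn ha0.le ha1 hp1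
  obtain ⟨F, A, V, hV, hAm, hAε, hAV, hcover⟩ := exists_cover_isOffOrigin hk hε
  obtain ⟨γ, hγ0, hγ1, hγ⟩ := exists_locallyHolder_besselPotential (n := n) hα_pos
    (β := β) (by rw [hβ]; linarith)
  refine ⟨γ, hγ0, hγ1, ?_⟩
  have hgrowth := ae_exists_occupationMeasure_closedBall_le (P := P) hX_meas hφ_meas hV hAm hAV
    hcover hβ0.le hpb
    (L := (p + 1).factorial * (ENNReal.ofReal C * (volume (univ : Set (unitCube k)) + K₀)) ^ p)
    (ENNReal.mul_ne_top (by simp) (ENNReal.pow_ne_top (ENNReal.mul_ne_top ENNReal.ofReal_ne_top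
      (ENNReal.add_ne_top.2 ⟨measure_ne_top _ _, hess.ne⟩))))
    (fun i r hr => ?_)
  · filter_upwards [hgrowth] with ω hω
    obtain ⟨D, hD, hball⟩ := hω
    have : IsFiniteMeasure (occupationMeasure fun t => X t ω + φ t) := by
      unfold occupationMeasure; infer_instance
    exact hγ _ D hD hball
  · refine (lintegral_volume_closeTuples_le hX_meas hφ_meas hr hinc hK (hAm i) (hAε i)).trans
      (le_of_eq ?_)
    have h1 : ENNReal.ofReal (C * r ^ (2 * n * a)) =
        ENNReal.ofReal C * ENNReal.ofReal (r ^ b) :=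
      ENNReal.ofReal_mul' (Real.rpow_nonneg hr.le _)
    have h2 : ENNReal.ofReal (r ^ (p * b)) = ENNReal.ofReal (r ^ b) ^ p := by
      rw [← ENNReal.ofReal_pow (Real.rpow_nonneg hr.le _), ← Real.rpow_natCast (r ^ b),
        ← Real.rpow_mul hr.le, mul_comm]
    rw [h1, h2]
    simp only [mul_pow]
    ring
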